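/- Let $k$ be a field of characteristic $0$. Let $Q_A$ be a finite quiver and let $Q_B$ be a subquiver of $Q_A$ with the same vertices. Let $A\cong kQ_A/J^2$ be the radical square zero algebra of $Q_A$, where $J$ is the ideal generated by the arrows, and let $B\subseteq A$ be the subalgebra generated by the vertices and the arrows of $Q_B$, which is the radical square zero algebra of $Q_B$. Let $\mathrm{HH}^1(A|B)=\mathrm{Der}_{B^e}(A)/\mathrm{Inn}_{B^e}(A)$ be the Lie algebra of the $k$-derivations of $A$ that are $B$-bimodule homomorphisms, modulo the inner derivations that are $B$-bimodule homomorphisms. Let $Q_C$ be the quiver with the vertices of $Q_A$ and the arrows of $Q_A$ that are not in $Q_B$. For a class $[\alpha]$ of parallel arrows of $Q_C$ let $|\alpha|$ be its cardinality. Let $S$ be the set of the classes with $|\alpha|>1$, let $\overline{E}$ be the set of the classes that are parallel to at least one arrow of $Q_B$, and let $\overline{D}$ be the set of the remaining classes. Write $\mathcal B$ for the set of paths of $Q_A$ of length at most $1$ (a basis of $A$). For a set $X$ of paths of $Q_A$ let $k(X//\mathcal B)$ be the vector space with basis the symbols $x//q$, for $x\in X$ and $q\in\mathcal B$ parallel to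 $x$. For arrows, the symbol $a//b$ stands for the derivation of $A$ with $a\mapsto b$ that kills the vertices and the other arrows, so that $[a//b,c//d]=\delta_{d,a}\,c//b-\delta_{b,c}\,a//d$. For a class $[\alpha]$ of $Q_C$ put $$\mathfrak I_\alpha=\langle a//b : a\in[\alpha],\ b \text{ an arrow of } Q_B \text{ parallel to } \alpha\rangle_k,\qquad I_\alpha=\sum_{a\in[\alpha]}a//a ,$$ and regard $\mathfrak{sl}_{|\alpha|}(k)$ as the trace zero part of $\mathfrak{gl}_{|\alpha|}(k)=\langle a//a' : a,a'\in[\alpha]\rangle_k$. Let $$\delta^0_A\colon k((Q_A)_0//\mathcal B)\to k((Q_A)_1//\mathcal B),\qquad \delta^0_A(e//q)=\sum_{s(a)=e,\ aq\in\mathcal B}a//aq-\sum_{t(a)=e,\ qa\in\mathcal B}a//qa$$ (paths are composed from right to left), and let $\mathrm{Im}(\delta^0_{A|B})$ be the space of the elements of $\mathrm{Im}(\delta^0_A)$ in which no arrow $a$ of $Q_B$ occurs in a term $a//q$; it is contained in $\prod_{[\alpha]\in\overline D}kI_\alpha$. Then there is an isomorphism of Lie algebras $$\mathrm{HH}^1(A|B)\;\cong\;\prod_{[\alpha]\in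 S}\mathfrak{sl}_{|\alpha|}(k)\ltimes\Bigl(\Bigl(\prod_{[\alpha]\in\overline E}\mathfrak I_\alpha\rtimes kI_\alpha\Bigr)\times\mathfrak a\Bigr),\qquad \mathfrak a=\Bigl(\prod_{[\alpha]\in\overline D}kI_\alpha\Bigr)\Big/\mathrm{Im}(\delta^0_{A|B}),$$ where $\mathfrak a$ is abelian. In the semidirect products, $kI_\alpha$ acts on $\mathfrak I_\alpha$ by the bracket above, and so does $\mathfrak{sl}_{|\alpha|}(k)$ for $[\alpha]\in S\cap\overline E$; all other actions of the factors $\mathfrak{sl}_{|\alpha|}(k)$ are zero. -/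

import Mathlib

noncomputable section

namespace RelHH

attribute [local instance] LieRing.ofAssociativeRing

/-! ### Products of Lie algebras -/

section PiLie

variable {ι : Type*} {L : ι → Type*} [∀ i, LieRing (L i)]

/-- The product of a family of Lie rings, with the componentwise bracket. -/
instance piLieRing : LieRing (∀ i, L i) where
  bracket x y := fun i => ⁅x i, y i⁆
  add_lie x y z := funext fun i => add_lie (x i) (y i) (z i)
  lie_add x y z := funext fun i => lie_add (x i) (y i) (z i)
  lie_self x := funext fun i => lie_self (x i)
  leibniz_lie x y z := funext fun i => leibniz_lie (x i) (y i) (z i)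

theorem pi_lie_apply (x y : ∀ i, L i) (i : ι) : ⁅x, y⁆ i = ⁅x i, y i⁆ := rfl

instance piLieAlgebra {k : Type*} [CommRing k] [∀ i, LieAlgebra k (L i)] :
    LieAlgebra k (∀ i, L i) where
  lie_smul t x y := funext fun i => lie_smul t (x i) (y i)

end PiLie

/-! ### The first relative Hochschild cohomology -/

section HH1

variable (k : Type*) [CommRing k] {A : Type*} [Ring A] [Algebra k A]

/-- `Der_{B^e}(A)`: the `k`-derivations `A → A` that are homomorphisms of `B`-bimodules, with the
commutator bracket.  These are the 1-cocycles of the relative bar complex. -/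
def relDer (B : Subalgebra k A) : LieSubalgebra k (Module.End k A) where
  carrier := {f | (∀ x y : A, f (x * y) = x * f y + f x * y) ∧
    (∀ b ∈ B, ∀ x : A, f (b * x) = b * f x) ∧ (∀ b ∈ B, ∀ x : A, f (x * b) = f x * b)}
  add_mem' := by
    rintro f g ⟨hf, hf', hf''⟩ ⟨hg, hg', hg''⟩
    refine ⟨fun x y => ?_, fun b hb x => ?_, fun b hb x => ?_⟩
    · simp only [LinearMap.add_apply, hf, hg, mul_add, add_mul]; abel
    · simp only [LinearMap.add_apply, hf' b hb, hg' b hb, mul_add]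
    · simp only [LinearMap.add_apply, hf'' b hb, hg'' b hb, add_mul]
  zero_mem' := by simp
  smul_mem' := by
    rintro c f ⟨hf, hf', hf''⟩
    refine ⟨fun x y => ?_, fun b hb x => ?_, fun b hb x => ?_⟩
    · simp [LinearMap.smul_apply, hf]
    · simp [LinearMap.smul_apply, hf' b hb]
    · simp [LinearMap.smul_apply, hf'' b hb]
  lie_mem' := by
    rintro f g ⟨hf, hf', hf''⟩ ⟨hg, hg', hg''⟩
    refine ⟨fun x y => ?_, fun b hb x => ?_, fun b hb x => ?_⟩
    · simp only [Ring.lie_def, LinearMap.sub_apply, Module.End.mul_apply, hf, hg, map_add,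
        mul_sub, sub_mul]
      abel
    · simp only [Ring.lie_def, LinearMap.sub_apply, Module.End.mul_apply, hf' b hb, hg' b hb,
        mul_sub]
    · simp only [Ring.lie_def, LinearMap.sub_apply, Module.End.mul_apply, hf'' b hb, hg'' b hb,
        sub_mul]

/-- `Inn_{B^e}(A)`: the inner derivations `[x, -]` that are homomorphisms of `B`-bimodules. -/
def relInn (B : Subalgebra k A) : LieIdeal k (relDer k B) where
  carrier := {f | ∃ x : A, ∀ y : A, f.1 y = x * y - y * x}
  add_mem' := by
    rintro f g ⟨x, hx⟩ ⟨z, hz⟩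
    refine ⟨x + z, fun y => ?_⟩
    have : (f + g).1 y = f.1 y + g.1 y := rfl
    rw [this, hx, hz, add_mul, mul_add]; abel
  zero_mem' := ⟨0, fun y => by simp⟩
  smul_mem' := by
    rintro c f ⟨x, hx⟩
    refine ⟨c • x, fun y => ?_⟩
    have : (c • f).1 y = c • f.1 y := rfl
    rw [this, hx, smul_sub, smul_mul_assoc, mul_smul_comm]
  lie_mem := by
    rintro f g ⟨x, hx⟩
    refine ⟨f.1 x, fun y => ?_⟩
    have : (⁅f, g⁆ : relDer k B).1 y = f.1 (g.1 y) - g.1 (f.1 y) := rfl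
    rw [this, hx, hx, map_sub, f.2.1, f.2.1]
    abel

/-- The Lie algebra `HH¹(A|B) = Der_{B^e}(A) / Inn_{B^e}(A)`. -/
abbrev HH1 (B : Subalgebra k A) : Type _ := relDer k B ⧸ relInn k B

end HH1

/-! ### Path algebras and radical square zero algebras -/

section PathAlgebra

open Quiver

/-- The underlying space of the path algebra `kQ` of a quiver with finitely many vertices: an
element is a finite linear combination of paths `i → j` for all vertices `i`, `j`. -/
def PathAlgebra (k V : Type*) [Semiring k] [Quiver V] : Type _ :=
  ∀ i j : V, Path i j →₀ k

namespace PathAlgebra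

variable {k V : Type*} [CommRing k] [Quiver V]

instance : AddCommGroup (PathAlgebra k V) :=
  inferInstanceAs (AddCommGroup (∀ i j : V, Path i j →₀ k))

instance : Module k (PathAlgebra k V) :=
  inferInstanceAs (Module k (∀ i j : V, Path i j →₀ k))

/-- Bilinear extension of the concatenation of paths (first `i → l`, then `l → j`). -/
def compL (i l j : V) : (Path i l →₀ k) →ₗ[k] (Path l j →₀ k) →ₗ[k] (Path i j →₀ k) :=
  Finsupp.linearCombination k fun p : Path i l => Finsupp.lmapDomain k k fun q => p.comp q

theorem compL_single {i l j : V} (p : Path i l) (q : Path l j) (c d : k) :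
    compL i l j (Finsupp.single p c) (Finsupp.single q d) = Finsupp.single (p.comp q) (c * d) := by
  simp [compL, Finsupp.mapDomain_single]

theorem compL_assoc {i l m j : V} (x : Path i l →₀ k) (y : Path l m →₀ k) (z : Path m j →₀ k) :
    compL i m j (compL i l m x y) z = compL i l j x (compL l m j y z) := by
  induction x using Finsupp.induction_linear with
  | zero => simp
  | add x x' h h' => simp [h, h']
  | single p c =>
    induction y using Finsupp.induction_linear with
    | zero => simp
    | add y y' h h' => simp [h, h']
    | single q d =>
      induction z using Finsupp.induction_linear with
      | zero => simp
      | add z z' h h' => simp only [map_add, h, h']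
      | single r e => simp only [compL_single, Path.comp_assoc, mul_assoc]

theorem nil_compL {i j : V} (y : Path i j →₀ k) :
    compL i i j (Finsupp.single Path.nil 1) y = y := by
  induction y using Finsupp.induction_linear with
  | zero => simp
  | add y y' h h' => simp [h, h']
  | single q d => simp [compL_single]

theorem compL_nil {i j : V} (x : Path i j →₀ k) :
    compL i j j x (Finsupp.single Path.nil 1) = x := by
  induction x using Finsupp.induction_linear with
  | zero => simp
  | add y y' h h' => simp [h, h']
  | single q d => simp [compL_single]

open Classical in
/-- The path `p`, as an element of the path algebra. -/
def ofPath {i j : V} (p : Path i j) : PathAlgebra k V :=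
  Pi.single i (Pi.single j (Finsupp.single p 1))

theorem add_apply (x y : PathAlgebra k V) (i j : V) : (x + y) i j = x i j + y i j := rfl

theorem smul_apply (c : k) (x : PathAlgebra k V) (i j : V) : (c • x) i j = c • x i j := rfl

theorem zero_apply (i j : V) : (0 : PathAlgebra k V) i j = 0 := rfl

open Classical in
instance : One (PathAlgebra k V) where
  one := fun i => Pi.single i (Finsupp.single Path.nil 1)

theorem one_apply_self (i : V) : (1 : PathAlgebra k V) i i = Finsupp.single Path.nil 1 := by
  classical
  exact Pi.single_eq_same (M := fun j => Path i j →₀ k) i _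

theorem one_apply_ne {i j : V} (h : j ≠ i) : (1 : PathAlgebra k V) i j = 0 := by
  classical
  exact Pi.single_eq_of_ne (M := fun j => Path i j →₀ k) h _

variable [Fintype V]

/-- Paths are composed from right to left: `x * y` is "first `y`, then `x`". -/
instance : Mul (PathAlgebra k V) where
  mul x y := fun i j => ∑ l : V, compL i l j (y i l) (x l j)

theorem mul_apply (x y : PathAlgebra k V) (i j : V) :
    (x * y) i j = ∑ l : V, compL i l j (y i l) (x l j) := rfl

instance : Ring (PathAlgebra k V) where
  left_distrib x y z := by
    funext i j; simp [mul_apply, add_apply, Finset.sum_add_distrib]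
  right_distrib x y z := by
    funext i j; simp [mul_apply, add_apply, Finset.sum_add_distrib]
  zero_mul x := by funext i j; simp [mul_apply, zero_apply]
  mul_zero x := by funext i j; simp [mul_apply, zero_apply]
  mul_assoc x y z := by
    funext i j
    simp only [mul_apply, map_sum, LinearMap.sum_apply, compL_assoc]
    exact Finset.sum_comm
  one_mul x := by
    funext i j
    rw [mul_apply, Finset.sum_eq_single j, one_apply_self, compL_nil]
    · intro l _ hl
      rw [one_apply_ne (Ne.symm hl), map_zero]
    · simp
  mul_one x := by
    funext i j
    rw [mul_apply, Finset.sum_eq_single i, one_apply_self, nil_compL]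
    · intro l _ hl
      rw [one_apply_ne hl, map_zero, LinearMap.zero_apply]
    · simp
  zsmul := fun n x => n • x
  zsmul_zero' x := zero_zsmul x
  zsmul_succ' n x := SubNegMonoid.zsmul_succ' n x
  zsmul_neg' n x := SubNegMonoid.zsmul_neg' n x
  neg_add_cancel x := neg_add_cancel x
  nsmul := fun n x => n • x
  nsmul_zero x := zero_nsmul x
  nsmul_succ n x := succ_nsmul x n
  sub_eq_add_neg x y := sub_eq_add_neg x y

instance : Algebra k (PathAlgebra k V) :=
  Algebra.ofModule
    (fun c x y => by funext i j; simp [mul_apply, smul_apply, Finset.smul_sum])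
    (fun c x y => by funext i j; simp [mul_apply, smul_apply, Finset.smul_sum])

/-- The path algebra of a wide subquiver `Q_B` of `Q_A`, as a subalgebra of the path algebra of
`Q_A`: it is generated by all vertices and the arrows of `Q_B`. -/
def ofSubquiver (k : Type*) [CommRing k] {V : Type*} [Quiver V] [Fintype V]
    (QB : WideSubquiver V) : Subalgebra k (PathAlgebra k V) :=
  Algebra.adjoin k ({x | ∃ i : V, x = ofPath (Path.nil : Path i i)} ∪
    {x | ∃ (i j : V) (a : i ⟶ j), a ∈ QB i j ∧ x = ofPath a.toPath})

/-- The square of the arrow ideal of `kQ`: the two-sided ideal generated by the paths of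
length two. -/
def arrowIdealSq (k V : Type*) [CommRing k] [Quiver V] [Fintype V] :
    TwoSidedIdeal (PathAlgebra k V) :=
  TwoSidedIdeal.span {x | ∃ (i j : V) (p : Path i j), p.length = 2 ∧ x = ofPath p}

end PathAlgebra

/-- `ν : kQ_A → A` presents `A` as the radical square zero algebra of the quiver `Q_A` (on the
vertex set `V`), and presents the subalgebra `B` as the radical square zero subalgebra of the
subquiver `Q_B`: the kernel of `ν` is generated by all paths of length two, and `B` is the image
of the path algebra of `Q_B`. -/
structure IsRadSqZeroPair {k V A : Type*} [CommRing k] [Quiver V] [Fintype V] [Ring A]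
    [Algebra k A] (ν : PathAlgebra k V →ₐ[k] A) (QB : WideSubquiver V) (B : Subalgebra k A) :
    Prop where
  surjective : Function.Surjective ν
  ker_eq : TwoSidedIdeal.ker ν = PathAlgebra.arrowIdealSq k V
  image_eq : (PathAlgebra.ofSubquiver k QB).map ν = B

end PathAlgebra

/-! ### Parallel arrows and the combinatorial complex -/

section Combinatorics

open Quiver

variable (k : Type*) [Field k] {V : Type*} [Quiver V] (QB : WideSubquiver V)

/-- The arrows of `Q_A` from `p.1` to `p.2`; this is a class of parallel arrows when non-empty. -/
abbrev Arr (p : V × V) : Type _ := p.1 ⟶ p.2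

/-- The arrows from `p.1` to `p.2` of the complement quiver `Q_C` of `Q_A` by the arrows of
`Q_B`. -/
abbrev CArr (p : V × V) : Type _ := {a : Arr p // a ∉ QB p.1 p.2}

/-- The classes `[α]` of parallel arrows of `Q_C`: a class is given by its source and target.
The class has the `|α|` elements of `CArr QB p`. -/
def classes : Set (V × V) := {p | Nonempty (CArr QB p)}

/-- `S`: the classes of `Q_C` with more than one arrow. -/
def classesS : Set (V × V) := {p | p ∈ classes QB ∧ 1 < Nat.card (CArr QB p)}

/-- The classes of `Q_C` to which no arrow of `Q_B` is parallel. -/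
def classesD : Set (V × V) := {p | p ∈ classes QB ∧ ¬ ∃ b : Arr p, b ∈ QB p.1 p.2}

/-- The classes of `Q_C` to which some arrow of `Q_B` is parallel. -/
def classesE : Set (V × V) := {p | p ∈ classes QB ∧ ∃ b : Arr p, b ∈ QB p.1 p.2}

/-- The basis `𝓑` of `kQ/J²` given by the paths of length at most one: the part from `i` to `j`. -/
abbrev BPath (i j : V) : Type _ := {p : Path i j // p.length ≤ 1}

open Classical in
/-- The class in `kQ/J²` of a path of `Q`, expressed in the basis `𝓑`. -/
def toB {i j : V} (p : Path i j) : BPath i j →₀ k :=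
  if h : p.length ≤ 1 then Finsupp.single ⟨p, h⟩ 1 else 0

/-- `k(Q₀ // 𝓑)`: the coefficient of `e_i // q` in `g` is `g i q`. -/
abbrev Cochain0 (k V : Type*) [Field k] [Quiver V] : Type _ := ∀ i : V, BPath i i →₀ k

/-- `k(Q₁ // 𝓑)`: the coefficient of `a // q` in `f` is `f p a q`, for an arrow `a` from `p.1` to
`p.2`. -/
abbrev Cochain1 (k V : Type*) [Field k] [Quiver V] : Type _ :=
  ∀ p : V × V, Arr p → (BPath p.1 p.2 →₀ k)

/-- `δ⁰(e // q) = ∑_{s(a) = e, aq ∈ 𝓑} a // aq - ∑_{t(a) = e, qa ∈ 𝓑} a // qa`. -/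
def delta0 (k V : Type*) [Field k] [Quiver V] : Cochain0 k V →ₗ[k] Cochain1 k V where
  toFun g := fun p a =>
    Finsupp.linearCombination k (fun q : BPath p.1 p.1 => toB k (q.1.comp a.toPath)) (g p.1) -
    Finsupp.linearCombination k (fun q : BPath p.2 p.2 => toB k (a.toPath.comp q.1)) (g p.2)
  map_add' g h := by
    funext p a
    simp only [Pi.add_apply, map_add]; abel
  map_smul' c g := by
    funext p a
    simp only [Pi.smul_apply, map_smul, smul_sub, RingHom.id_apply]

/-- `Im(δ⁰_{A|B})`: the elements of `Im(δ⁰_A)` whose restriction to the arrows of `Q_B` is zero. -/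
def imDelta0 : Submodule k (Cochain1 k V) where
  carrier := {f | f ∈ LinearMap.range (delta0 k V) ∧
    ∀ (p : V × V) (a : Arr p), a ∈ QB p.1 p.2 → f p a = 0}
  add_mem' := by
    rintro f g ⟨hf, hf'⟩ ⟨hg, hg'⟩
    exact ⟨add_mem hf hg, fun p a ha => by simp [hf' p a ha, hg' p a ha]⟩
  zero_mem' := ⟨zero_mem _, fun _ _ _ => rfl⟩
  smul_mem' := by
    rintro c f ⟨hf, hf'⟩
    exact ⟨Submodule.smul_mem _ c hf, fun p a ha => by simp [hf' p a ha]⟩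

end Combinatorics

/-! ### The Lie algebras in the decomposition -/

section Decomposition

open Quiver Classical

/-- A Lie algebra homomorphism `f : L → 𝔤` whose image normalizes the Lie subalgebra `N` of `𝔤`
makes `L` act on `N` by derivations, `x ↦ [f x, -]`. -/
def adAct {k L 𝔤 : Type*} [CommRing k] [LieRing L] [LieAlgebra k L] [LieRing 𝔤] [LieAlgebra k 𝔤]
    (N : LieSubalgebra k 𝔤) (f : L →ₗ⁅k⁆ 𝔤) (h : ∀ x : L, ∀ y ∈ N, ⁅f x, y⁆ ∈ N) :
    L →ₗ⁅k⁆ LieDerivation k N N where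
  toFun x :=
    { toFun := fun y => ⟨⁅f x, y.1⁆, h x y.1 y.2⟩
      map_add' := fun y z => Subtype.ext (lie_add (f x) y.1 z.1)
      map_smul' := fun c y => Subtype.ext (lie_smul c (f x) y.1)
      leibniz' := fun y z => Subtype.ext (by
        change ⁅f x, ⁅y.1, z.1⁆⁆ = ⁅y.1, ⁅f x, z.1⁆⁆ - ⁅z.1, ⁅f x, y.1⁆⁆
        rw [leibniz_lie (f x) y.1 z.1, ← lie_skew z.1 ⁅f x, y.1⁆]; abel) }
  map_add' x y := LieDerivation.ext fun z => Subtype.ext (by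
    change ⁅f (x + y), z.1⁆ = ⁅f x, z.1⁆ + ⁅f y, z.1⁆
    rw [map_add, add_lie])
  map_smul' c x := LieDerivation.ext fun z => Subtype.ext (by
    change ⁅f (c • x), z.1⁆ = c • ⁅f x, z.1⁆
    rw [map_smul, smul_lie])
  map_lie' {x y} := LieDerivation.ext fun z => by
    rw [LieDerivation.commutator_apply]
    apply Subtype.ext
    change ⁅f ⁅x, y⁆, z.1⁆ = ⁅f x, ⁅f y, z.1⁆⁆ - ⁅f y, ⁅f x, z.1⁆⁆
    rw [LieHom.map_lie, lie_lie]

/-- If the action `φ` of `L` on `N` commutes with the action `ψ` of `H` on `N`, then `L` acts on the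
semidirect sum of `N` and `H` by derivations, through `φ` on `N` and by zero on `H`. -/
def semiAct {k L N H : Type*} [CommRing k] [LieRing L] [LieAlgebra k L] [LieRing N]
    [LieAlgebra k N] [LieRing H] [LieAlgebra k H] (ψ : H →ₗ⁅k⁆ LieDerivation k N N)
    (φ : L →ₗ⁅k⁆ LieDerivation k N N) (h : ∀ (s : L) (x : H) (y : N), φ s (ψ x y) = ψ x (φ s y)) :
    L →ₗ⁅k⁆ LieDerivation k (LieAlgebra.SemiDirectSum N H ψ)
      (LieAlgebra.SemiDirectSum N H ψ) where
  toFun s :=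
    { toFun := fun r => ⟨φ s r.left, 0⟩
      map_add' := fun r r' => by ext1 <;> simp
      map_smul' := fun c r => by ext1 <;> simp
      leibniz' := fun r r' => by
        ext1
        · simp [h]; abel
        · simp }
  map_add' s t := by ext r <;> simp
  map_smul' c s := by ext r <;> simp
  map_lie' {s t} := by
    ext r
    · simp
    · simp

/-- The componentwise action by derivations on a product of Lie algebras. -/
def piAct {k L ι : Type*} {M : ι → Type*} [CommRing k] [LieRing L] [LieAlgebra k L]
    [∀ i, LieRing (M i)] [∀ i, LieAlgebra k (M i)]
    (φ : ∀ i, L →ₗ⁅k⁆ LieDerivation k (M i) (M i)) :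
    L →ₗ⁅k⁆ LieDerivation k (∀ i, M i) (∀ i, M i) where
  toFun s :=
    { toFun := fun r i => φ i s (r i)
      map_add' := fun r r' => funext fun i => map_add (φ i s) (r i) (r' i)
      map_smul' := fun c r => funext fun i => map_smul (φ i s) c (r i)
      leibniz' := fun r r' => funext fun i => (φ i s).leibniz' (r i) (r' i) }
  map_add' s t := LieDerivation.ext fun r => funext fun i => by
    change φ i (s + t) (r i) = φ i s (r i) + φ i t (r i)
    rw [map_add]; rfl
  map_smul' c s := LieDerivation.ext fun r => funext fun i => by
    change φ i (c • s) (r i) = c • φ i s (r i)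
    rw [map_smul]; rfl
  map_lie' {s t} := LieDerivation.ext fun r => funext fun i => by
    rw [LieDerivation.commutator_apply]
    change φ i ⁅s, t⁆ (r i) = φ i s (φ i t (r i)) - φ i t (φ i s (r i))
    rw [LieHom.map_lie, LieDerivation.commutator_apply]

/-- An action of `L` on `M` by derivations, extended by zero to an action on `M × P`. -/
def prodAct {k L M P : Type*} [CommRing k] [LieRing L] [LieAlgebra k L] [LieRing M]
    [LieAlgebra k M] [LieRing P] [LieAlgebra k P] (φ : L →ₗ⁅k⁆ LieDerivation k M M) :
    L →ₗ⁅k⁆ LieDerivation k (M × P) (M × P) where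
  toFun s :=
    { toFun := fun r => (φ s r.1, 0)
      map_add' := fun r r' => by simp
      map_smul' := fun c r => by simp
      leibniz' := fun r r' => Prod.ext ((φ s).leibniz' r.1 r'.1) (by
        change (0 : P) = ⁅r.2, (0 : P)⁆ - ⁅r'.2, (0 : P)⁆
        rw [lie_zero, lie_zero, sub_zero]) }
  map_add' s t := by ext r <;> simp
  map_smul' c s := by ext r <;> simp
  map_lie' {s t} := by
    ext r
    · simp
    · simp

variable (k : Type*) [Field k] {V : Type*} [Quiver V] [∀ i j : V, Fintype (i ⟶ j)]
  (QB : WideSubquiver V)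

/-- For a class `p` of parallel arrows of `Q_A`, the span of the `a // b` with `a`, `b` in the
class, with the bracket `[a // b, c // d] = δ_{d,a} c // b - δ_{b,c} a // d`.  This is the space of
square matrices with the commutator bracket, `a // b` being the matrix unit with its one in row `b`
and column `a` (the linear map `a ↦ b`). -/
abbrev ParLie (p : V × V) : Type _ := Matrix (Arr p) (Arr p) k

/-- `ℑ_α`: the span of the `a // b` with `a` an arrow of `Q_C` and `b` an arrow of `Q_B` in the
class `p`. -/
def frakI (p : V × V) : LieSubalgebra k (ParLie k p) where
  carrier := {M | ∀ b a : Arr p, (a ∈ QB p.1 p.2 ∨ b ∉ QB p.1 p.2) → M b a = 0}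
  add_mem' := by
    intro M N hM hN b a h
    rw [Matrix.add_apply, hM b a h, hN b a h, add_zero]
  zero_mem' := fun _ _ _ => rfl
  smul_mem' := by
    intro c M hM b a h
    rw [Matrix.smul_apply, hM b a h, smul_zero]
  lie_mem' := by
    intro M N hM hN b a h
    have key : ∀ M' N' : ParLie k p,
        (∀ b a : Arr p, (a ∈ QB p.1 p.2 ∨ b ∉ QB p.1 p.2) → M' b a = 0) →
        (∀ b a : Arr p, (a ∈ QB p.1 p.2 ∨ b ∉ QB p.1 p.2) → N' b a = 0) → (M' * N') b a = 0 := by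
      intro M' N' hM' hN'
      rw [Matrix.mul_apply]
      refine Finset.sum_eq_zero fun c _ => ?_
      by_cases hc : c ∈ QB p.1 p.2
      · rw [hM' b c (Or.inl hc), zero_mul]
      · rw [hN' c a (Or.inr hc), mul_zero]
    rw [Ring.lie_def, Matrix.sub_apply, key M N hM hN, key N M hN hM, sub_zero]

/-- `I_α = ∑ a // a`, the sum over the arrows `a` of `Q_C` in the class `p`. -/
def elI (p : V × V) : ParLie k p :=
  Matrix.diagonal fun a => if a ∈ QB p.1 p.2 then 0 else 1

/-- `k I_α`. -/
def lineI (p : V × V) : LieSubalgebra k (ParLie k p) where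
  toSubmodule := Submodule.span k {elI k QB p}
  lie_mem' := by
    intro M N hM hN
    obtain ⟨c, rfl⟩ := Submodule.mem_span_singleton.1 hM
    obtain ⟨d, rfl⟩ := Submodule.mem_span_singleton.1 hN
    rw [smul_lie, lie_smul, lie_self, smul_zero, smul_zero]
    exact Submodule.zero_mem _

theorem elI_lie_mem (p : V × V) (N : ParLie k p) (hN : N ∈ frakI k QB p) :
    ⁅elI k QB p, N⁆ ∈ frakI k QB p := by
  intro b a h
  rw [Ring.lie_def, Matrix.sub_apply, elI, Matrix.diagonal_mul, Matrix.mul_diagonal, hN b a h]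
  simp

theorem lineI_lie_mem (p : V × V) (x : lineI k QB p) (N : ParLie k p) (hN : N ∈ frakI k QB p) :
    ⁅(lineI k QB p).incl x, N⁆ ∈ frakI k QB p := by
  obtain ⟨x, hx⟩ := x
  obtain ⟨c, rfl⟩ := Submodule.mem_span_singleton.1 hx
  change ⁅c • elI k QB p, N⁆ ∈ frakI k QB p
  rw [smul_lie]
  exact (frakI k QB p).smul_mem c (elI_lie_mem k QB p N hN)

/-- `ℑ_α ⋊ k I_α`, where `k I_α` acts on `ℑ_α` by the bracket of `ParLie k p`. -/
abbrev IkI (p : V × V) : Type _ :=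
  LieAlgebra.SemiDirectSum (frakI k QB p) (lineI k QB p)
    (adAct (frakI k QB p) (lineI k QB p).incl (lineI_lie_mem k QB p))

/-- `∏_{[α] ∈ D} k I_α`. -/
abbrev ProdD : Type _ := ∀ p : classesD QB, lineI k QB p.1

/-- The inclusion of `∏_{[α] ∈ D} k I_α` in `k(Q₁ // 𝓑)`. -/
def prodDIncl : ProdD k QB →ₗ[k] Cochain1 k V where
  toFun x := fun p a =>
    if h : p ∈ classesD QB then ∑ b : Arr p, (x ⟨p, h⟩).1 b a • toB k b.toPath else 0
  map_add' x y := by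
    funext p a
    by_cases h : p ∈ classesD QB
    · simp [h, add_smul, Finset.sum_add_distrib]
    · simp [h]
  map_smul' c x := by
    funext p a
    by_cases h : p ∈ classesD QB
    · simp [h, mul_smul, Finset.smul_sum]
    · simp [h]

theorem lineI_lie (p : V × V) (x y : lineI k QB p) : ⁅x, y⁆ = 0 := by
  obtain ⟨x, hx⟩ := x
  obtain ⟨y, hy⟩ := y
  obtain ⟨c, rfl⟩ := Submodule.mem_span_singleton.1 hx
  obtain ⟨d, rfl⟩ := Submodule.mem_span_singleton.1 hy
  apply Subtype.ext
  change ⁅c • elI k QB p, d • elI k QB p⁆ = 0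
  rw [smul_lie, lie_smul, lie_self, smul_zero, smul_zero]

/-- `Im(δ⁰_{A|B})` as an ideal of `∏_{[α] ∈ D} k I_α`; see `imDelta0_le_range`. -/
def imIdeal : LieIdeal k (ProdD k QB) where
  toSubmodule := (imDelta0 k QB).comap (prodDIncl k QB)
  lie_mem := by
    intro x y _
    have : ⁅x, y⁆ = 0 := funext fun p => lineI_lie k QB p.1 (x p) (y p)
    rw [this]
    exact Submodule.zero_mem _

/-- `𝔞 = (∏_{[α] ∈ D} k I_α) / Im(δ⁰_{A|B})`. -/
abbrev frakA : Type _ := ProdD k QB ⧸ imIdeal k QB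

/-- The radical part `(∏_{[α] ∈ E} ℑ_α ⋊ k I_α) × 𝔞`. -/
abbrev RadPart : Type _ := (∀ p : classesE QB, IkI k QB p.1) × frakA k QB

/-- `∏_{[α] ∈ S} 𝔰𝔩_{|α|}(k)`, where `𝔰𝔩_{|α|}(k)` is realized on the arrows of `[α]`. -/
abbrev SlPart : Type _ := ∀ p : classesS QB, LieAlgebra.SpecialLinear.sl (CArr QB p.1) k

/-- Extension by zero of a matrix indexed by the arrows of `Q_C` in the class `p`: the copy of
`𝔤𝔩_{|α|}(k)` spanned by the `a // b` with `a`, `b` arrows of `Q_C`. -/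
def extC (p : V × V) (M : Matrix (CArr QB p) (CArr QB p) k) : ParLie k p :=
  Matrix.of fun b a =>
    if h : b ∉ QB p.1 p.2 ∧ a ∉ QB p.1 p.2 then M ⟨b, h.1⟩ ⟨a, h.2⟩ else 0

theorem extC_add (p : V × V) (M N : Matrix (CArr QB p) (CArr QB p) k) :
    extC k QB p (M + N) = extC k QB p M + extC k QB p N := by
  ext b a
  by_cases h : b ∉ QB p.1 p.2 ∧ a ∉ QB p.1 p.2 <;> simp [extC, h]

theorem extC_smul (p : V × V) (c : k) (M : Matrix (CArr QB p) (CArr QB p) k) :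
    extC k QB p (c • M) = c • extC k QB p M := by
  ext b a
  by_cases h : b ∉ QB p.1 p.2 ∧ a ∉ QB p.1 p.2 <;> simp [extC, h]

theorem extC_mul (p : V × V) (M N : Matrix (CArr QB p) (CArr QB p) k) :
    extC k QB p (M * N) = extC k QB p M * extC k QB p N := by
  ext b a
  rw [Matrix.mul_apply]
  by_cases hb : b ∈ QB p.1 p.2
  · simp [extC, hb]
  by_cases ha : a ∈ QB p.1 p.2
  · simp [extC, ha]
  have h1 : extC k QB p (M * N) b a = ∑ c : CArr QB p, M ⟨b, hb⟩ c * N c ⟨a, ha⟩ := by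
    simp [extC, hb, ha, Matrix.mul_apply]
  have h2 : ∀ c : CArr QB p, M ⟨b, hb⟩ c * N c ⟨a, ha⟩ =
      extC k QB p M b c.1 * extC k QB p N c.1 a := by
    intro c
    simp [extC, hb, ha, c.2]
  rw [h1, Finset.sum_congr rfl fun c _ => h2 c]
  rw [← Fintype.sum_subtype_add_sum_subtype (fun c : Arr p => c ∉ QB p.1 p.2)
    fun c => extC k QB p M b c * extC k QB p N c a]
  rw [Finset.sum_eq_zero (s := (Finset.univ : Finset {c : Arr p // ¬ c ∉ QB p.1 p.2})), add_zero]
  intro c _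
  simp [extC, not_not.1 c.2]

theorem extC_lie_mem (p : V × V) (M : Matrix (CArr QB p) (CArr QB p) k) (N : ParLie k p)
    (hN : N ∈ frakI k QB p) : ⁅extC k QB p M, N⁆ ∈ frakI k QB p := by
  intro b a h
  have h1 : (extC k QB p M * N) b a = 0 := by
    rw [Matrix.mul_apply]
    refine Finset.sum_eq_zero fun c _ => ?_
    by_cases hc : c ∈ QB p.1 p.2
    · simp [extC, hc]
    · rw [hN c a (Or.inr hc), mul_zero]
  have h2 : (N * extC k QB p M) b a = 0 := by
    rw [Matrix.mul_apply]
    refine Finset.sum_eq_zero fun c _ => ?_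
    rcases h with h | h
    · simp [extC, h]
    · rw [hN b c (Or.inr h), zero_mul]
  rw [Ring.lie_def, Matrix.sub_apply, h1, h2, sub_zero]

theorem extC_lie_elI (p : V × V) (M : Matrix (CArr QB p) (CArr QB p) k) :
    ⁅extC k QB p M, elI k QB p⁆ = 0 := by
  ext b a
  rw [Ring.lie_def, Matrix.sub_apply, elI, Matrix.diagonal_mul, Matrix.mul_diagonal]
  by_cases hb : b ∈ QB p.1 p.2
  · simp [extC, hb]
  by_cases ha : a ∈ QB p.1 p.2
  · simp [extC, ha]
  simp [ha, hb]

/-- The component at the class `p` of an element of `∏_{[α] ∈ S} 𝔰𝔩_{|α|}(k)`, as an element of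
`ParLie k p` (zero if `p` is not in `S`). -/
def slAt (p : V × V) : SlPart k QB →ₗ⁅k⁆ ParLie k p where
  toFun s := if h : p ∈ classesS QB then extC k QB p (s ⟨p, h⟩).1 else 0
  map_add' s t := by
    by_cases h : p ∈ classesS QB
    · simp only [h, dite_true]
      exact extC_add k QB p _ _
    · simp [h]
  map_smul' c s := by
    by_cases h : p ∈ classesS QB
    · simp only [h, dite_true]
      exact extC_smul k QB p c _
    · simp [h]
  map_lie' {s t} := by
    by_cases h : p ∈ classesS QB
    · simp only [h, dite_true]
      rw [pi_lie_apply, LieAlgebra.SpecialLinear.sl_bracket, Ring.lie_def, ← extC_mul, ← extC_mul,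
        eq_sub_iff_add_eq, ← extC_add, sub_add_cancel]
    · simp [h]

theorem slAt_lie_mem (p : V × V) (s : SlPart k QB) (N : ParLie k p) (hN : N ∈ frakI k QB p) :
    ⁅slAt k QB p s, N⁆ ∈ frakI k QB p := by
  change ⁅(if h : p ∈ classesS QB then extC k QB p (s ⟨p, h⟩).1 else 0 : ParLie k p), N⁆ ∈ _
  split_ifs with h
  · exact extC_lie_mem k QB p _ N hN
  · rw [zero_lie]
    exact zero_mem _

theorem slAt_lie_lineI (p : V × V) (s : SlPart k QB) (x : lineI k QB p) :
    ⁅slAt k QB p s, x.1⁆ = 0 := by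
  obtain ⟨x, hx⟩ := x
  obtain ⟨c, rfl⟩ := Submodule.mem_span_singleton.1 hx
  change ⁅(if h : p ∈ classesS QB then extC k QB p (s ⟨p, h⟩).1 else 0 : ParLie k p),
    c • elI k QB p⁆ = 0
  split_ifs with h
  · rw [lie_smul, extC_lie_elI, smul_zero]
  · rw [zero_lie]

/-- The action of `∏_{[α] ∈ S} 𝔰𝔩_{|α|}(k)` on `ℑ_p` by the bracket of `ParLie k p`. -/
def slActI (p : V × V) : SlPart k QB →ₗ⁅k⁆ LieDerivation k (frakI k QB p) (frakI k QB p) :=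
  adAct (frakI k QB p) (slAt k QB p) (slAt_lie_mem k QB p)

theorem slActI_comm (p : V × V) (s : SlPart k QB) (x : lineI k QB p) (N : frakI k QB p) :
    slActI k QB p s (adAct (frakI k QB p) (lineI k QB p).incl (lineI_lie_mem k QB p) x N) =
    adAct (frakI k QB p) (lineI k QB p).incl (lineI_lie_mem k QB p) x (slActI k QB p s N) := by
  apply Subtype.ext
  change ⁅slAt k QB p s, ⁅x.1, N.1⁆⁆ = ⁅x.1, ⁅slAt k QB p s, N.1⁆⁆
  rw [leibniz_lie, slAt_lie_lineI, zero_lie, zero_add]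

/-- The action of `∏_{[α] ∈ S} 𝔰𝔩_{|α|}(k)` on `(∏_{[α] ∈ E} ℑ_α ⋊ k I_α) × 𝔞` by derivations: it
acts on each `ℑ_α` by the bracket of `ParLie`, and by zero on each `k I_α` and on `𝔞` (the
matrices in `𝔰𝔩_{|α|}(k)` commute with `I_α`). -/
def slAct : SlPart k QB →ₗ⁅k⁆ LieDerivation k (RadPart k QB) (RadPart k QB) :=
  prodAct (piAct fun p : classesE QB => semiAct _ (slActI k QB p.1) (slActI_comm k QB p.1))

/-- `∏_{[α] ∈ S} 𝔰𝔩_{|α|}(k) ⋉ ((∏_{[α] ∈ E} ℑ_α ⋊ k I_α) × 𝔞)`. -/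
abbrev Decomp : Type _ :=
  LieAlgebra.SemiDirectSum (RadPart k QB) (SlPart k QB) (slAct k QB)

theorem linearCombination_left {p : V × V} (a : Arr p) (g : BPath p.1 p.1 →₀ k) :
    Finsupp.linearCombination k (fun q : BPath p.1 p.1 => toB k (q.1.comp a.toPath)) g =
      g ⟨Path.nil, by simp⟩ • toB k a.toPath := by
  induction g using Finsupp.induction_linear with
  | zero => simp
  | add x y hx hy => rw [map_add, hx, hy, Finsupp.add_apply, add_smul]
  | single q c =>
    obtain ⟨q, hq⟩ := q
    rw [Finsupp.linearCombination_single]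
    by_cases h0 : q.length = 0
    · obtain rfl := Path.eq_nil_of_length_zero q h0
      simp [Hom.toPath]
    · have h1 : toB k (q.comp a.toPath) = 0 := by
        simp [toB, h0]
      have h2 : (⟨q, hq⟩ : BPath p.1 p.1) ≠ ⟨Path.nil, by simp⟩ := by
        rintro h
        have h' : q = Path.nil := congrArg Subtype.val h
        exact h0 (by rw [h']; rfl)
      rw [h1, Finsupp.single_eq_of_ne (Ne.symm h2), smul_zero, zero_smul]

theorem linearCombination_right {p : V × V} (a : Arr p) (g : BPath p.2 p.2 →₀ k) :
    Finsupp.linearCombination k (fun q : BPath p.2 p.2 => toB k (a.toPath.comp q.1)) g =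
      g ⟨Path.nil, by simp⟩ • toB k a.toPath := by
  induction g using Finsupp.induction_linear with
  | zero => simp
  | add x y hx hy => rw [map_add, hx, hy, Finsupp.add_apply, add_smul]
  | single q c =>
    obtain ⟨q, hq⟩ := q
    rw [Finsupp.linearCombination_single]
    by_cases h0 : q.length = 0
    · obtain rfl := Path.eq_nil_of_length_zero q h0
      simp
    · have h1 : toB k (a.toPath.comp q) = 0 := by
        simp [toB, Path.length_comp, Path.length_toPath, h0]
      have h2 : (⟨q, hq⟩ : BPath p.2 p.2) ≠ ⟨Path.nil, by simp⟩ := by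
        rintro h
        have h' : q = Path.nil := congrArg Subtype.val h
        exact h0 (by rw [h']; rfl)
      rw [h1, Finsupp.single_eq_of_ne (Ne.symm h2), smul_zero, zero_smul]

/-- `Im(δ⁰_{A|B})` is contained in `∏_{[α] ∈ D} k I_α`. -/
theorem imDelta0_le_range : imDelta0 k QB ≤ LinearMap.range (prodDIncl k QB) := by
  rintro f ⟨⟨g, rfl⟩, hf⟩
  let c : V × V → k := fun p => g p.1 ⟨Path.nil, by simp⟩ - g p.2 ⟨Path.nil, by simp⟩
  have hg : ∀ (p : V × V) (a : Arr p), delta0 k V g p a = c p • toB k a.toPath := by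
    intro p a
    simp only [delta0, LinearMap.coe_mk, AddHom.coe_mk]
    rw [linearCombination_left, linearCombination_right, ← sub_smul]
  refine ⟨fun p => ⟨c p.1 • elI k QB p.1, Submodule.mem_span_singleton.2 ⟨_, rfl⟩⟩, ?_⟩
  funext p a
  rw [hg]
  change (if h : p ∈ classesD QB then
    ∑ b : Arr p, (c p • elI k QB p) b a • toB k b.toPath else 0) = _
  split_ifs with h
  · have ha : a ∉ QB p.1 p.2 := fun ha => h.2 ⟨a, ha⟩
    rw [Finset.sum_eq_single a]
    · simp [elI, ha]
    · intro b _ hb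
      simp [elI, Matrix.diagonal_apply_ne _ hb]
    · simp
  · symm
    by_cases ha : a ∈ QB p.1 p.2
    · rw [← hg, hf p a ha]
    · have : ∃ b : Arr p, b ∈ QB p.1 p.2 := by
        by_contra hb
        exact h ⟨⟨⟨a, ha⟩⟩, hb⟩
      obtain ⟨b, hb⟩ := this
      have h1 := hf p b hb
      rw [hg] at h1
      have h2 : c p = 0 := by
        have := congrArg (fun z => z ⟨b.toPath, by simp⟩) h1
        simpa [toB] using this
      rw [h2, zero_smul]

end Decomposition

end RelHH

/-!
A derivation `f` of `A` that kills `B` kills the vertices, hence preserves the space spanned by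
the arrows of each class of parallel arrows: if `f a` had a component along a vertex, then `a`
would be a loop with `a * a = 0`, and Leibniz gives twice that component times `a`, so it
vanishes as `2 ≠ 0`. So `f` is a family of matrices `M p`, one for each pair of vertices, with
zero columns at the arrows of `Q_B`, and any such family occurs. Splitting off the rows of `Q_B`
and the normalized trace of the `Q_C` block decomposes the Lie algebra of these matrices as
`𝔰𝔩 ⋉ (𝔍 ⋊ k I)`; the scalar part is complemented by `𝔰𝔩` because `|α| ≠ 0` in `k`. The inner
derivations that kill the vertices are the families of scalar matrices `(g i - g j) • 1`. One that
kills the arrows of `Q_B` vanishes on every class parallel to one of them, so it lies in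
`∏ k I_α` over the remaining classes: it is an element of `Im(δ⁰_{A|B})`.
-/

namespace RelHH

attribute [local instance] LieRing.ofAssociativeRing

open Quiver

namespace PathAlgebra

section Paths

variable {k V : Type*} [CommRing k] [Quiver V]

theorem ofPath_apply_self {i j : V} (p : Path i j) :
    (ofPath p : PathAlgebra k V) i j = Finsupp.single p 1 := by
  simp [ofPath]

theorem ofPath_apply_of_ne_left {i j l : V} (p : Path i j) (hl : l ≠ i) (m : V) :
    (ofPath p : PathAlgebra k V) l m = 0 := by
  simp [ofPath, hl]

theorem ofPath_apply_of_ne_right {i j m : V} (p : Path i j) (l : V) (hm : m ≠ j) :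
    (ofPath p : PathAlgebra k V) l m = 0 := by
  rcases eq_or_ne l i with rfl | hl
  · simp [ofPath, hm]
  · exact ofPath_apply_of_ne_left p hl m

theorem ofPath_mul_ofPath [Fintype V] {i j l : V} (p : Path i j) (q : Path j l) :
    (ofPath q * ofPath p : PathAlgebra k V) = ofPath (p.comp q) := by
  funext a b
  rw [mul_apply, Finset.sum_eq_single j]
  · rcases eq_or_ne a i with rfl | ha
    · rcases eq_or_ne b l with rfl | hb
      · simp only [ofPath_apply_self, compL_single, one_mul]
      · rw [ofPath_apply_of_ne_right q _ hb, ofPath_apply_of_ne_right _ _ hb, map_zero]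
    · rw [ofPath_apply_of_ne_left p ha, ofPath_apply_of_ne_left _ ha, map_zero,
        LinearMap.zero_apply]
  · intro c _ hc
    rw [ofPath_apply_of_ne_right p _ hc, map_zero, LinearMap.zero_apply]
  · exact fun h => absurd (Finset.mem_univ j) h

theorem ofPath_mul_ofPath_of_ne [Fintype V] {i j l m : V} (p : Path i j) (q : Path l m)
    (h : j ≠ l) : (ofPath q * ofPath p : PathAlgebra k V) = 0 := by
  funext a b
  rw [mul_apply, zero_apply]
  refine Finset.sum_eq_zero fun c _ => ?_
  rcases eq_or_ne c j with rfl | hc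
  · rw [ofPath_apply_of_ne_left q h, map_zero]
  · rw [ofPath_apply_of_ne_right p _ hc, map_zero, LinearMap.zero_apply]

theorem orthogonalIdempotents_ofPath_nil [Fintype V] :
    OrthogonalIdempotents fun i : V => (ofPath (Path.nil : Quiver.Path i i) : PathAlgebra k V) where
  idem i := by rw [IsIdempotentElem, ofPath_mul_ofPath, Path.comp_nil]
  ortho _ _ h := ofPath_mul_ofPath_of_ne _ _ h.symm

end Paths

section LongPaths

variable (k V : Type*) [CommRing k] [Quiver V] [Fintype V]

/-- The basis of the path algebra given by all paths. -/
def pathBasis : Module.Basis (Σ i j : V, Path i j) k (PathAlgebra k V) :=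
  Pi.basis fun _ => Pi.basis fun _ => Finsupp.basisSingleOne

variable {k V} in
open Classical in
theorem pathBasis_apply (x : Σ i j : V, Path i j) : pathBasis k V x = ofPath x.2.2 := by
  obtain ⟨i, j, p⟩ := x
  refine (Pi.basis_apply (Ms := fun i => ∀ j, Quiver.Path i j →₀ k) _ _).trans ?_
  rw [Pi.basis_apply, Finsupp.coe_basisSingleOne, ofPath]

/-- The span of the paths of length at least `n`, that is, the `n`-th power of the arrow ideal. -/
def longPaths (n : ℕ) : Submodule k (PathAlgebra k V) :=
  Submodule.span k (pathBasis k V '' {x | n ≤ x.2.2.length})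

variable {k V}

theorem ofPath_mem_longPaths {n : ℕ} {i j : V} {p : Path i j} (hp : n ≤ p.length) :
    ofPath p ∈ longPaths k V n :=
  Submodule.subset_span ⟨⟨i, j, p⟩, hp, pathBasis_apply _⟩

theorem longPaths_zero : longPaths k V 0 = ⊤ := by
  simp only [longPaths, Nat.zero_le, Set.ofPred_true, Set.image_univ, Module.Basis.span_eq]

theorem longPaths_mul_longPaths_le (m n : ℕ) :
    longPaths k V m * longPaths k V n ≤ longPaths k V (m + n) := by
  rw [longPaths, longPaths, Submodule.span_mul_span, Submodule.span_le]
  rintro _ ⟨_, ⟨⟨i, j, p⟩, hp, rfl⟩, _, ⟨⟨l, m', q⟩, hq, rfl⟩, rfl⟩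
  simp only [Set.mem_ofPred_eq] at hp hq
  simp only [pathBasis_apply]
  rcases eq_or_ne m' i with rfl | h
  · rw [ofPath_mul_ofPath]
    exact ofPath_mem_longPaths (by rw [Path.length_comp]; omega)
  · rw [ofPath_mul_ofPath_of_ne q p h]
    exact zero_mem _

theorem mul_mem_longPaths_left {n : ℕ} (x : PathAlgebra k V) {y : PathAlgebra k V}
    (hy : y ∈ longPaths k V n) : x * y ∈ longPaths k V n := by
  have hx : x ∈ longPaths k V 0 := longPaths_zero (k := k) (V := V) ▸ Submodule.mem_top
  simpa only [zero_add] using longPaths_mul_longPaths_le 0 n (Submodule.mul_mem_mul hx hy)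

theorem mul_mem_longPaths_right {n : ℕ} {x : PathAlgebra k V} (hx : x ∈ longPaths k V n)
    (y : PathAlgebra k V) : x * y ∈ longPaths k V n := by
  have hy : y ∈ longPaths k V 0 := longPaths_zero (k := k) (V := V) ▸ Submodule.mem_top
  exact longPaths_mul_longPaths_le n 0 (Submodule.mul_mem_mul hx hy)

theorem ofPath_mem_arrowIdealSq {i j : V} (p : Path i j) (hp : 2 ≤ p.length) :
    ofPath p ∈ arrowIdealSq k V := by
  induction p with
  | nil => simp at hp
  | @cons b c p a ih =>
    rcases Nat.lt_or_ge p.length 2 with h | h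
    · have hlen : (p.cons a).length = 2 := by
        rw [Path.length_cons] at hp ⊢
        omega
      exact TwoSidedIdeal.subset_span ⟨_, _, _, hlen, rfl⟩
    · rw [show p.cons a = p.comp a.toPath from rfl, ← ofPath_mul_ofPath]
      exact TwoSidedIdeal.mul_mem_left _ _ _ (ih h)

theorem mem_arrowIdealSq_iff {x : PathAlgebra k V} :
    x ∈ arrowIdealSq k V ↔ x ∈ longPaths k V 2 := by
  constructor
  · intro hx
    let I : TwoSidedIdeal (PathAlgebra k V) := .mk' (longPaths k V 2) (zero_mem _) add_mem neg_mem
      (fun {x y} hy => mul_mem_longPaths_left x hy)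
      (fun {x y} hx => mul_mem_longPaths_right hx y)
    have hI : arrowIdealSq k V ≤ I := by
      refine TwoSidedIdeal.span_le.2 ?_
      rintro _ ⟨i, j, p, hp, rfl⟩
      exact (TwoSidedIdeal.mem_mk' ..).2 (ofPath_mem_longPaths hp.ge)
    exact (TwoSidedIdeal.mem_mk' ..).1 (hI hx)
  · intro hx
    induction hx using Submodule.span_induction with
    | mem x hx =>
      obtain ⟨y, hy, rfl⟩ := hx
      rw [pathBasis_apply]
      exact ofPath_mem_arrowIdealSq _ hy
    | zero => exact zero_mem _
    | add x y _ _ hx hy => exact add_mem hx hy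
    | smul c x _ hx =>
      rw [Algebra.smul_def]
      exact TwoSidedIdeal.mul_mem_left _ _ _ hx

end LongPaths

end PathAlgebra

/-- A basis of `A` consisting of the vertices and the arrows of the quiver `V`, multiplied as in
the radical square zero algebra of `V`. -/
structure ArrowBasis (k V A : Type*) [CommRing k] [Quiver V] [Ring A] [Algebra k A] where
  /-- The basis element of a vertex. -/
  vert : V → A
  /-- The basis element of an arrow. -/
  arrow : ∀ p : V × V, Arr p → A
  /-- The basis consisting of all `vert i` and all `arrow p a`. -/
  basis : Module.Basis (V ⊕ Σ p : V × V, Arr p) k A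
  basis_inl : ∀ i, basis (.inl i) = vert i
  basis_inr : ∀ a, basis (.inr a) = arrow a.1 a.2
  orthogonalIdempotents : OrthogonalIdempotents vert
  vert_mul_arrow : ∀ (p : V × V) (a : Arr p), vert p.2 * arrow p a = arrow p a
  arrow_mul_vert : ∀ (p : V × V) (a : Arr p), arrow p a * vert p.1 = arrow p a
  arrow_mul_arrow : ∀ (p q : V × V) (a : Arr p) (b : Arr q), arrow p a * arrow q b = 0

namespace ArrowBasis

/-- The subalgebra generated by the vertices and the arrows of a subquiver. -/
def subalgebra {k V A : Type*} [CommRing k] [Quiver V] [Ring A] [Algebra k A]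
    (β : ArrowBasis k V A) (QB : WideSubquiver V) : Subalgebra k A :=
  Algebra.adjoin k (Set.range β.vert ∪
    {x | ∃ (p : V × V) (a : Arr p), a ∈ QB p.1 p.2 ∧ x = β.arrow p a})

end ArrowBasis

section ShortPaths

variable {V : Type*} [Quiver V]

/-- The paths of length at most one, indexed by the vertices and the arrows. -/
def shortPath : V ⊕ (Σ p : V × V, Arr p) → Σ i j : V, Path i j :=
  Sum.elim (fun i => ⟨i, i, Path.nil⟩) (fun a => ⟨a.1.1, a.1.2, a.2.toPath⟩)

theorem shortPath_injective : Function.Injective (shortPath (V := V)) := by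
  rintro (i | ⟨⟨i, j⟩, a⟩) (i' | ⟨⟨i', j'⟩, a'⟩) h
  · simp_all [shortPath]
  · simpa [shortPath] using congrArg (fun x => x.2.2.length) h
  · simpa [shortPath] using congrArg (fun x => x.2.2.length) h
  · simp only [shortPath, Sum.elim_inr, Sigma.mk.injEq] at h
    obtain ⟨rfl, h⟩ := h
    simp only [heq_eq_eq, Sigma.mk.injEq] at h
    obtain ⟨rfl, h⟩ := h
    rw [eq_of_heq (Path.hom_heq_of_cons_eq_cons (eq_of_heq h))]

theorem range_shortPath :
    Set.range (shortPath (V := V)) = {x | x.2.2.length < 2} := by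
  ext ⟨i, j, p⟩
  constructor
  · rintro ⟨i' | a, h⟩ <;> simp [← h, shortPath]
  · intro h
    match p with
    | .nil => exact ⟨.inl i, rfl⟩
    | .cons .nil a => exact ⟨.inr ⟨(_, _), a⟩, rfl⟩
    | .cons (.cons _ _) _ => simp at h

end ShortPaths

namespace IsRadSqZeroPair

open PathAlgebra

variable {k V A : Type*} [CommRing k] [Quiver V] [Fintype V] [Ring A] [Algebra k A]
  {ν : PathAlgebra k V →ₐ[k] A} {QB : WideSubquiver V} {B : Subalgebra k A}

theorem map_eq_zero_iff (hν : IsRadSqZeroPair ν QB B) {x : PathAlgebra k V} :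
    ν x = 0 ↔ x ∈ longPaths k V 2 := by
  rw [← mem_arrowIdealSq_iff, ← hν.ker_eq, TwoSidedIdeal.mem_ker]

theorem linearIndependent_shortPath (hν : IsRadSqZeroPair ν QB B) :
    LinearIndependent k fun x => ν (pathBasis k V (shortPath x)) := by
  have hli := (pathBasis k V).linearIndependent
  refine (hli.comp shortPath shortPath_injective).map (f := ν.toLinearMap) ?_
  have hker : LinearMap.ker ν.toLinearMap = longPaths k V 2 :=
    Submodule.ext fun x => hν.map_eq_zero_iff
  rw [hker, Set.range_comp, range_shortPath]
  exact hli.disjoint_span_image (Set.disjoint_left.2 fun _ => by simp)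

theorem span_shortPath (hν : IsRadSqZeroPair ν QB B) :
    ⊤ ≤ Submodule.span k (Set.range fun x => ν (pathBasis k V (shortPath x))) := by
  have hν_top : Submodule.map ν.toLinearMap (Submodule.span k (Set.range (pathBasis k V))) = ⊤ := by
    rw [Module.Basis.span_eq, Submodule.map_top]
    exact LinearMap.range_eq_top.2 hν.surjective
  rw [← hν_top, Submodule.map_span, Submodule.span_le]
  rintro _ ⟨_, ⟨x, rfl⟩, rfl⟩
  rcases lt_or_ge x.2.2.length 2 with hx | hx
  · obtain ⟨y, rfl⟩ := range_shortPath.ge hx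
    exact Submodule.subset_span ⟨y, rfl⟩
  · have hzero : ν (pathBasis k V x) = 0 := by
      rw [hν.map_eq_zero_iff, pathBasis_apply]
      exact ofPath_mem_longPaths hx
    exact hzero ▸ zero_mem _

theorem map_arrow_mul_map_arrow (hν : IsRadSqZeroPair ν QB B) (p q : V × V) (a : Arr p)
    (b : Arr q) :
    ν (ofPath a.toPath) * ν (ofPath b.toPath) = 0 := by
  obtain ⟨i, j⟩ := p
  obtain ⟨l, m⟩ := q
  rw [← map_mul]
  rcases eq_or_ne m i with rfl | h
  · rw [ofPath_mul_ofPath, hν.map_eq_zero_iff]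
    exact ofPath_mem_longPaths (by simp)
  · rw [ofPath_mul_ofPath_of_ne _ _ h, map_zero]

/-- The basis of `A` given by the images of the vertices and the arrows. -/
def arrowBasis (hν : IsRadSqZeroPair ν QB B) : ArrowBasis k V A where
  vert i := ν (ofPath Path.nil)
  arrow p a := ν (ofPath a.toPath)
  basis := .mk hν.linearIndependent_shortPath hν.span_shortPath
  basis_inl i := by rw [Module.Basis.mk_apply, pathBasis_apply]; rfl
  basis_inr a := by rw [Module.Basis.mk_apply, pathBasis_apply]; rfl
  orthogonalIdempotents := .map ν.toRingHom orthogonalIdempotents_ofPath_nil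
  vert_mul_arrow p a := by rw [← map_mul, ofPath_mul_ofPath, Path.comp_nil]
  arrow_mul_vert p a := by rw [← map_mul, ofPath_mul_ofPath, Path.nil_comp]
  arrow_mul_arrow := hν.map_arrow_mul_map_arrow

theorem subalgebra_arrowBasis (hν : IsRadSqZeroPair ν QB B) : hν.arrowBasis.subalgebra QB = B := by
  refine Eq.trans ?_ hν.image_eq
  rw [ofSubquiver, AlgHom.map_adjoin, ArrowBasis.subalgebra, Set.image_union]
  congr 2
  · ext x
    constructor
    · rintro ⟨i, rfl⟩
      exact ⟨_, ⟨i, rfl⟩, rfl⟩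
    · rintro ⟨_, ⟨i, rfl⟩, rfl⟩
      exact ⟨i, rfl⟩
  · ext x
    constructor
    · rintro ⟨p, a, ha, rfl⟩
      exact ⟨_, ⟨p.1, p.2, a, ha, rfl⟩, rfl⟩
    · rintro ⟨_, ⟨i, j, a, ha, rfl⟩, rfl⟩
      exact ⟨(i, j), a, ha, rfl⟩

end IsRadSqZeroPair

namespace ArrowBasis

section Multiplication

variable {k V A : Type*} [CommRing k] [Quiver V] [Ring A] [Algebra k A] (β : ArrowBasis k V A)

theorem linearMap_ext {N : Type*} [AddCommMonoid N] [Module k N] {f g : A →ₗ[k] N}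
    (hv : ∀ i, f (β.vert i) = g (β.vert i)) (ha : ∀ p a, f (β.arrow p a) = g (β.arrow p a)) :
    f = g := by
  refine β.basis.ext ?_
  rintro (i | a)
  · simpa only [basis_inl] using hv i
  · simpa only [basis_inr] using ha a.1 a.2

/-- The coefficient of a vertex in the basis of the vertices and the arrows. -/
def vCoeff (i : V) : A →ₗ[k] k := β.basis.coord (.inl i)

/-- The coefficient of an arrow in the basis of the vertices and the arrows. -/
def aCoeff (p : V × V) (a : Arr p) : A →ₗ[k] k := β.basis.coord (.inr ⟨p, a⟩)

theorem vCoeff_vert_self (i : V) : β.vCoeff i (β.vert i) = 1 := by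
  simp [vCoeff, ← basis_inl]

theorem vCoeff_vert_of_ne {i j : V} (h : i ≠ j) : β.vCoeff i (β.vert j) = 0 := by
  simp [vCoeff, ← basis_inl, h]

theorem vCoeff_arrow (i : V) (p : V × V) (a : Arr p) : β.vCoeff i (β.arrow p a) = 0 := by
  simp [vCoeff, ← β.basis_inr ⟨p, a⟩]

theorem aCoeff_vert (p : V × V) (a : Arr p) (i : V) : β.aCoeff p a (β.vert i) = 0 := by
  simp [aCoeff, ← basis_inl]

theorem aCoeff_arrow (p : V × V) [DecidableEq (Arr p)] (b a : Arr p) :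
    β.aCoeff p b (β.arrow p a) = if b = a then 1 else 0 := by
  classical
  simp [aCoeff, ← β.basis_inr ⟨p, _⟩, Finsupp.single_apply, eq_comm]

theorem aCoeff_arrow_of_ne {p q : V × V} (h : p ≠ q) (b : Arr p) (a : Arr q) :
    β.aCoeff p b (β.arrow q a) = 0 := by
  simp [aCoeff, ← β.basis_inr ⟨q, a⟩, h.symm]

theorem vert_mul_self (i : V) : β.vert i * β.vert i = β.vert i := β.orthogonalIdempotents.idem i

theorem vert_mul_vert_of_ne {i j : V} (h : i ≠ j) : β.vert i * β.vert j = 0 :=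
  β.orthogonalIdempotents.ortho h

theorem vert_mul_arrow_of_ne {i : V} {p : V × V} (h : i ≠ p.2) (a : Arr p) :
    β.vert i * β.arrow p a = 0 := by
  rw [← β.vert_mul_arrow p a, ← mul_assoc, β.vert_mul_vert_of_ne h, zero_mul]

theorem arrow_mul_vert_of_ne {i : V} {p : V × V} (h : p.1 ≠ i) (a : Arr p) :
    β.arrow p a * β.vert i = 0 := by
  rw [← β.arrow_mul_vert p a, mul_assoc, β.vert_mul_vert_of_ne h, mul_zero]

theorem mul_arrow (x : A) (p : V × V) (a : Arr p) :
    x * β.arrow p a = β.vCoeff p.2 x • β.arrow p a := by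
  suffices h : LinearMap.mulRight k (β.arrow p a) =
      (β.vCoeff p.2).smulRight (β.arrow p a) from LinearMap.congr_fun h x
  refine β.linearMap_ext (fun i => ?_) fun q b => ?_
  · rcases eq_or_ne p.2 i with rfl | hi
    · simp [vert_mul_arrow, vCoeff_vert_self]
    · simp [β.vert_mul_arrow_of_ne hi.symm, β.vCoeff_vert_of_ne hi]
  · simp [arrow_mul_arrow, vCoeff_arrow]

theorem arrow_mul (p : V × V) (a : Arr p) (x : A) :
    β.arrow p a * x = β.vCoeff p.1 x • β.arrow p a := by
  suffices h : LinearMap.mulLeft k (β.arrow p a) =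
      (β.vCoeff p.1).smulRight (β.arrow p a) from LinearMap.congr_fun h x
  refine β.linearMap_ext (fun i => ?_) fun q b => ?_
  · rcases eq_or_ne p.1 i with rfl | hi
    · simp [arrow_mul_vert, vCoeff_vert_self]
    · simp [β.arrow_mul_vert_of_ne hi, β.vCoeff_vert_of_ne hi]
  · simp [arrow_mul_arrow, vCoeff_arrow]

theorem vert_mul_mul_vert (p : V × V) [Fintype (Arr p)] (x : A) :
    β.vert p.2 * x * β.vert p.1 =
      β.vCoeff p.1 x • (β.vert p.2 * β.vert p.1) + ∑ a, β.aCoeff p a x • β.arrow p a := by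
  classical
  suffices h : LinearMap.mulRight k (β.vert p.1) ∘ₗ LinearMap.mulLeft k (β.vert p.2) =
      (β.vCoeff p.1).smulRight (β.vert p.2 * β.vert p.1) +
        ∑ a, (β.aCoeff p a).smulRight (β.arrow p a) by
    simpa using LinearMap.congr_fun h x
  refine β.linearMap_ext (fun i => ?_) fun q b => ?_
  · rcases eq_or_ne p.1 i with rfl | hi
    · simp [mul_assoc, vert_mul_self, vCoeff_vert_self, aCoeff_vert]
    · simp [mul_assoc, β.vert_mul_vert_of_ne hi.symm, β.vCoeff_vert_of_ne hi, aCoeff_vert]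
  · rcases eq_or_ne p q with rfl | hq
    · simp [vert_mul_arrow, arrow_mul_vert, vCoeff_arrow, aCoeff_arrow]
    · suffices h : β.vert p.2 * β.arrow q b * β.vert p.1 = 0 by
        simpa [vCoeff_arrow, β.aCoeff_arrow_of_ne hq] using h
      rcases eq_or_ne p.2 q.2 with h₂ | h₂
      · rw [h₂, vert_mul_arrow, β.arrow_mul_vert_of_ne fun h₁ => hq (Prod.ext h₁.symm h₂)]
      · rw [β.vert_mul_arrow_of_ne h₂, zero_mul]

variable {β} {QB : WideSubquiver V}

theorem vert_mem_subalgebra (i : V) : β.vert i ∈ β.subalgebra QB :=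
  Algebra.subset_adjoin (Or.inl ⟨i, rfl⟩)

theorem arrow_mem_subalgebra {p : V × V} {a : Arr p} (ha : a ∈ QB p.1 p.2) :
    β.arrow p a ∈ β.subalgebra QB :=
  Algebra.subset_adjoin (Or.inr ⟨p, a, ha, rfl⟩)

theorem mem_relDer_of_map_eq_zero {f : Module.End k A}
    (hf : ∀ x y : A, f (x * y) = x * f y + f x * y) (hv : ∀ i, f (β.vert i) = 0)
    (ha : ∀ (p : V × V) (a : Arr p), a ∈ QB p.1 p.2 → f (β.arrow p a) = 0) :
    f ∈ relDer k (β.subalgebra QB) := by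
  have map_one : f 1 = 0 := by simpa using hf 1 1
  have map_subalgebra : ∀ b ∈ β.subalgebra QB, f b = 0 := by
    intro b hb
    induction hb using Algebra.adjoin_induction with
    | mem x hx =>
      obtain ⟨i, rfl⟩ | ⟨p, a, h, rfl⟩ := hx
      exacts [hv i, ha p a h]
    | algebraMap r => rw [Algebra.algebraMap_eq_smul_one, map_smul, map_one, smul_zero]
    | add x y _ _ hx hy => rw [map_add, hx, hy, add_zero]
    | mul x y _ _ hx hy => rw [hf, hx, hy, mul_zero, zero_mul, add_zero]
  exact ⟨hf, fun b hb x => by rw [hf, map_subalgebra b hb, zero_mul, add_zero],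
    fun b hb x => by rw [hf, map_subalgebra b hb, mul_zero, zero_add]⟩

end Multiplication

end ArrowBasis

theorem map_eq_zero_of_mem_relDer {k A : Type*} [CommRing k] [Ring A] [Algebra k A]
    {B : Subalgebra k A} {f : Module.End k A} (hf : f ∈ relDer k B) {b : A} (hb : b ∈ B) :
    f b = 0 := by
  have map_one : f 1 = 0 := by simpa using hf.1 1 1
  simpa [map_one] using hf.2.1 b hb 1

section RelParLie

variable (k : Type*) [Field k] {V : Type*} [Quiver V] [∀ i j : V, Fintype (i ⟶ j)]
  (QB : WideSubquiver V)

open scoped Classical in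
/-- The span of the `a // b` with `a` an arrow of `Q_C` and `b` any arrow of `Q_A` in the class
`p`: the matrices whose columns at the arrows of `Q_B` are zero. -/
def relParLie (p : V × V) : LieSubalgebra k (ParLie k p) where
  carrier := {M | ∀ b a : Arr p, a ∈ QB p.1 p.2 → M b a = 0}
  add_mem' hM hN b a ha := by rw [Matrix.add_apply, hM b a ha, hN b a ha, add_zero]
  zero_mem' _ _ _ := rfl
  smul_mem' c M hM b a ha := by rw [Matrix.smul_apply, hM b a ha, smul_zero]
  lie_mem' {M N} hM hN b a ha := by
    simp [Ring.lie_def, Matrix.mul_apply, hM _ a ha, hN _ a ha]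

variable {k}

open scoped Classical in
/-- The matrices of `δ⁰(∑ i, g i • e_i // e_i)`, one for each pair of vertices. -/
def coboundary (g : V → k) (p : V × V) : ParLie k p :=
  (g p.1 - g p.2) • 1

end RelParLie

namespace ArrowBasis

variable {k V A : Type*} [Field k] [Quiver V] [Ring A] [Algebra k A] (β : ArrowBasis k V A)

/-- The matrix by which a linear map acts on the arrows of a parallel class, modulo the other
basis elements. -/
def matrixAt (p : V × V) : Module.End k A →ₗ[k] ParLie k p where
  toFun f := Matrix.of fun b a => β.aCoeff p b (f (β.arrow p a))
  map_add' f g := by ext; simp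
  map_smul' c f := by ext; simp

theorem matrixAt_apply (p : V × V) (f : Module.End k A) (b a : Arr p) :
    β.matrixAt p f b a = β.aCoeff p b (f (β.arrow p a)) := rfl

theorem vCoeff_map_loop {β : ArrowBasis k V A} [NeZero (2 : k)] {f : Module.End k A}
    (hf : ∀ x y : A, f (x * y) = x * f y + f x * y) (i : V) (a : i ⟶ i) :
    β.vCoeff i (f (β.arrow (i, i) a)) = 0 := by
  have leibniz := hf (β.arrow (i, i) a) (β.arrow (i, i) a)
  rw [arrow_mul_arrow, map_zero, arrow_mul, mul_arrow, ← add_smul, ← two_mul] at leibniz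
  have arrow_ne_zero : β.arrow (i, i) a ≠ 0 := β.basis_inr ⟨(i, i), a⟩ ▸ β.basis.ne_zero _
  simpa [arrow_ne_zero, NeZero.ne] using leibniz.symm

variable [∀ i j : V, Fintype (i ⟶ j)]

/-- The linear map that kills the vertices and acts on the arrows of each parallel class by a
matrix. -/
def derOf (M : ∀ p : V × V, ParLie k p) : Module.End k A :=
  β.basis.constr k (Sum.elim 0 fun a => ∑ b, M a.1 b a.2 • β.arrow a.1 b)

theorem derOf_vert (M : ∀ p : V × V, ParLie k p) (i : V) : β.derOf M (β.vert i) = 0 := by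
  rw [derOf, ← basis_inl, Module.Basis.constr_basis]
  rfl

theorem derOf_arrow (M : ∀ p : V × V, ParLie k p) (p : V × V) (a : Arr p) :
    β.derOf M (β.arrow p a) = ∑ b, M p b a • β.arrow p b := by
  rw [derOf, ← β.basis_inr ⟨p, a⟩, Module.Basis.constr_basis]
  rfl

theorem mul_derOf_arrow (M : ∀ p : V × V, ParLie k p) (x : A) (p : V × V) (a : Arr p) :
    x * β.derOf M (β.arrow p a) = β.vCoeff p.2 x • β.derOf M (β.arrow p a) := by
  simp only [derOf_arrow, Finset.mul_sum, mul_smul_comm, mul_arrow, Finset.smul_sum,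
    smul_comm (β.vCoeff p.2 x)]

theorem derOf_arrow_mul (M : ∀ p : V × V, ParLie k p) (p : V × V) (a : Arr p) (x : A) :
    β.derOf M (β.arrow p a) * x = β.vCoeff p.1 x • β.derOf M (β.arrow p a) := by
  simp only [derOf_arrow, Finset.sum_mul, smul_mul_assoc, arrow_mul, Finset.smul_sum,
    smul_comm (β.vCoeff p.1 x)]

theorem vCoeff_derOf (M : ∀ p : V × V, ParLie k p) (i : V) (x : A) :
    β.vCoeff i (β.derOf M x) = 0 := by
  suffices h : β.vCoeff i ∘ₗ β.derOf M = 0 from LinearMap.congr_fun h x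
  exact β.linearMap_ext (fun j => by simp [derOf_vert]) fun p a => by
    simp [derOf_arrow, vCoeff_arrow]

theorem derOf_mul_vert (M : ∀ p : V × V, ParLie k p) (x : A) (i : V) :
    β.derOf M (x * β.vert i) = β.derOf M x * β.vert i := by
  suffices h : β.derOf M ∘ₗ LinearMap.mulRight k (β.vert i) =
      LinearMap.mulRight k (β.vert i) ∘ₗ β.derOf M from LinearMap.congr_fun h x
  refine β.linearMap_ext (fun j => ?_) fun p a => ?_
  · rcases eq_or_ne j i with rfl | hj
    · simp [vert_mul_self, derOf_vert]
    · simp [β.vert_mul_vert_of_ne hj, derOf_vert]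
  · simp [arrow_mul, derOf_arrow_mul]

theorem derOf_mul (M : ∀ p : V × V, ParLie k p) (x y : A) :
    β.derOf M (x * y) = x * β.derOf M y + β.derOf M x * y := by
  suffices h : β.derOf M ∘ₗ LinearMap.mulLeft k x =
      LinearMap.mulLeft k x ∘ₗ β.derOf M + LinearMap.mulLeft k (β.derOf M x) from
    LinearMap.congr_fun h y
  refine β.linearMap_ext (fun i => ?_) fun p a => ?_
  · simp [derOf_mul_vert, derOf_vert]
  · simp [mul_arrow, mul_derOf_arrow, vCoeff_derOf]

theorem matrixAt_derOf (M : ∀ p : V × V, ParLie k p) (p : V × V) :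
    β.matrixAt p (β.derOf M) = M p := by
  classical
  ext b a
  simp [matrixAt_apply, derOf_arrow, aCoeff_arrow]

variable {β} {QB : WideSubquiver V}

theorem derOf_mem_relDer (M : ∀ p : V × V, relParLie k QB p) :
    β.derOf (fun p => (M p).1) ∈ relDer k (β.subalgebra QB) :=
  mem_relDer_of_map_eq_zero (β.derOf_mul _) (β.derOf_vert _) fun p a ha => by
    simp [derOf_arrow, (M p).2 _ a ha]

theorem matrixAt_mem_relParLie {f : Module.End k A} (hf : f ∈ relDer k (β.subalgebra QB))
    (p : V × V) : β.matrixAt p f ∈ relParLie k QB p := fun b a ha => by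
  rw [matrixAt_apply, map_eq_zero_of_mem_relDer hf (arrow_mem_subalgebra ha), map_zero]

theorem map_arrow [NeZero (2 : k)] {f : Module.End k A}
    (hf : f ∈ relDer k (β.subalgebra QB)) (p : V × V) (a : Arr p) :
    f (β.arrow p a) = ∑ b, β.matrixAt p f b a • β.arrow p b := by
  have vert_part : β.vCoeff p.1 (f (β.arrow p a)) • (β.vert p.2 * β.vert p.1) = 0 := by
    obtain ⟨i, j⟩ := p
    rcases eq_or_ne j i with rfl | h
    · rw [vCoeff_map_loop hf.1, zero_smul]
    · rw [β.vert_mul_vert_of_ne h, smul_zero]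
  calc f (β.arrow p a)
      = f (β.vert p.2 * β.arrow p a * β.vert p.1) := by rw [vert_mul_arrow, arrow_mul_vert]
    _ = β.vert p.2 * f (β.arrow p a) * β.vert p.1 := by
        rw [hf.2.2 _ (vert_mem_subalgebra _), hf.2.1 _ (vert_mem_subalgebra _)]
    _ = _ := by rw [vert_mul_mul_vert, vert_part, zero_add]; rfl

theorem derOf_matrixAt [NeZero (2 : k)] {f : Module.End k A}
    (hf : f ∈ relDer k (β.subalgebra QB)) : β.derOf (fun p => β.matrixAt p f) = f :=
  β.linearMap_ext
    (fun i => by rw [derOf_vert, map_eq_zero_of_mem_relDer hf (vert_mem_subalgebra i)])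
    fun p a => by rw [derOf_arrow, map_arrow hf]

theorem matrixAt_mul [NeZero (2 : k)] (f : Module.End k A) {g : Module.End k A}
    (hg : g ∈ relDer k (β.subalgebra QB)) (p : V × V) :
    β.matrixAt p (f * g) = β.matrixAt p f * β.matrixAt p g := by
  ext b a
  rw [Matrix.mul_apply, matrixAt_apply, Module.End.mul_apply, map_arrow hg]
  simp [matrixAt_apply, mul_comm]

variable (β QB)

/-- The family of the matrices of a relative derivation on the classes of parallel arrows. -/
def relDerMatrices [NeZero (2 : k)] :
    relDer k (β.subalgebra QB) →ₗ⁅k⁆ ∀ p : V × V, relParLie k QB p where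
  toFun f p := ⟨β.matrixAt p f.1, matrixAt_mem_relParLie f.2 p⟩
  map_add' f g := funext fun p => Subtype.ext (map_add (β.matrixAt p) f.1 g.1)
  map_smul' c f := funext fun p => Subtype.ext (map_smul (β.matrixAt p) c f.1)
  map_lie' {f g} := by
    funext p
    refine Subtype.ext ?_
    change β.matrixAt p (f.1 * g.1 - g.1 * f.1) = _
    rw [map_sub, matrixAt_mul f.1 g.2, matrixAt_mul g.1 f.2]
    rfl

theorem coe_relDerMatrices_apply [NeZero (2 : k)] (f : relDer k (β.subalgebra QB)) (p : V × V) :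
    (β.relDerMatrices QB f p : ParLie k p) = β.matrixAt p f.1 := rfl

theorem relDerMatrices_surjective [NeZero (2 : k)] :
    Function.Surjective (β.relDerMatrices QB) := by
  intro M
  refine ⟨⟨β.derOf fun p => (M p).1, derOf_mem_relDer M⟩, funext fun p => Subtype.ext ?_⟩
  rw [coe_relDerMatrices_apply, matrixAt_derOf]

variable {QB}

theorem derOf_coboundary [Fintype V] (g : V → k) (y : A) :
    β.derOf (coboundary g) y = (∑ i, -g i • β.vert i) * y - y * ∑ i, -g i • β.vert i := by
  classical
  suffices h : β.derOf (coboundary g) = LinearMap.mulLeft k (∑ i, -g i • β.vert i) -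
      LinearMap.mulRight k (∑ i, -g i • β.vert i) by rw [h]; rfl
  refine β.linearMap_ext (fun i => ?_) fun p a => ?_
  · simp [derOf_vert, Finset.sum_mul, Finset.mul_sum, β.orthogonalIdempotents.mul_eq]
  · have vCoeff_sum (j : V) : β.vCoeff j (∑ i, -g i • β.vert i) = -g j := by
      rw [map_sum, Finset.sum_eq_single j]
      · simp [vCoeff_vert_self]
      · intro i _ hi
        simp [β.vCoeff_vert_of_ne hi.symm]
      · simp
    rw [derOf_arrow, LinearMap.sub_apply, LinearMap.mulLeft_apply, LinearMap.mulRight_apply,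
      mul_arrow, arrow_mul, vCoeff_sum, vCoeff_sum, ← sub_smul, neg_sub_neg]
    simp [coboundary, Matrix.one_apply]

theorem mem_relInn_iff [Finite V] [NeZero (2 : k)] {f : relDer k (β.subalgebra QB)} :
    f ∈ relInn k (β.subalgebra QB) ↔ ∃ g : V → k, ∀ p, β.matrixAt p f.1 = coboundary g p := by
  classical
  have := Fintype.ofFinite V
  constructor
  · rintro ⟨x, hx⟩
    refine ⟨fun i => -β.vCoeff i x, fun p => ?_⟩
    ext b a
    rw [matrixAt_apply, hx, mul_arrow, arrow_mul, ← sub_smul, map_smul, aCoeff_arrow,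
      coboundary, Matrix.smul_apply, Matrix.one_apply, neg_sub_neg]
  · rintro ⟨g, hg⟩
    refine ⟨∑ i, -g i • β.vert i, fun y => ?_⟩
    rw [← derOf_coboundary, ← funext hg, derOf_matrixAt f.2]

end ArrowBasis

section Traceless

variable {k n : Type*} [Field k] [Fintype n]

/-- The trace of a square matrix divided by its size, the coefficient of the identity in
`𝔤𝔩 = k ⊕ 𝔰𝔩`; it is `0` if the size vanishes in `k`. -/
def normTrace : Matrix n n k →ₗ[k] k :=
  (Nat.card n : k)⁻¹ • Matrix.traceLinearMap n k k

theorem normTrace_apply (X : Matrix n n k) : normTrace X = (Nat.card n : k)⁻¹ * X.trace := rfl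

variable [DecidableEq n]

theorem normTrace_lie (X Y : Matrix n n k) : normTrace ⁅X, Y⁆ = 0 := by
  rw [normTrace_apply, Ring.lie_def, Matrix.trace_sub, Matrix.trace_mul_comm, sub_self, mul_zero]

theorem normTrace_smul_one_add (hn : (Nat.card n : k) ≠ 0) (c : k) {T : Matrix n n k}
    (hT : T.trace = 0) : normTrace (c • 1 + T) = c := by
  rw [normTrace_apply, Matrix.trace_add, hT, add_zero, Matrix.trace_smul, Matrix.trace_one,
    ← Nat.card_eq_fintype_card, smul_eq_mul, mul_comm c, inv_mul_cancel_left₀ hn]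

/-- The projection of `𝔤𝔩` onto its trace zero part along the scalar matrices. -/
def tracelessPart : Matrix n n k →ₗ⁅k⁆ Matrix n n k where
  toFun X := X - normTrace X • 1
  map_add' X Y := by rw [map_add, add_smul, add_sub_add_comm]
  map_smul' c X := by rw [map_smul, smul_assoc, RingHom.id_apply, smul_sub]
  map_lie' {X Y} := by
    have lie_one (c : k) (Z : Matrix n n k) : ⁅Z, c • (1 : Matrix n n k)⁆ = 0 := by
      simp [Ring.lie_def]
    have one_lie (c : k) (Z : Matrix n n k) : ⁅c • (1 : Matrix n n k), Z⁆ = 0 := by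
      simp [Ring.lie_def]
    change ⁅X, Y⁆ - normTrace ⁅X, Y⁆ • 1 = ⁅X - normTrace X • 1, Y - normTrace Y • 1⁆
    rw [normTrace_lie, zero_smul, sub_lie, lie_sub, lie_one, one_lie, sub_zero, sub_zero]

theorem tracelessPart_apply (X : Matrix n n k) : tracelessPart X = X - normTrace X • 1 := rfl

theorem trace_tracelessPart (hn : (Nat.card n : k) ≠ 0) (X : Matrix n n k) :
    (tracelessPart X).trace = 0 := by
  rw [tracelessPart_apply, Matrix.trace_sub, Matrix.trace_smul, Matrix.trace_one, normTrace_apply,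
    ← Nat.card_eq_fintype_card, smul_eq_mul, mul_right_comm, inv_mul_cancel₀ hn, one_mul, sub_self]

theorem tracelessPart_smul_one_add (hn : (Nat.card n : k) ≠ 0) (c : k) {T : Matrix n n k}
    (hT : T.trace = 0) : tracelessPart (c • 1 + T) = T := by
  rw [tracelessPart_apply, normTrace_smul_one_add hn c hT, add_sub_cancel_left]

theorem tracelessPart_eq_zero [Subsingleton n] (X : Matrix n n k) : tracelessPart X = 0 := by
  ext i j
  have : Unique n := uniqueOfSubsingleton i
  simp [tracelessPart_apply, normTrace_apply, Matrix.trace, Subsingleton.elim i default,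
    Subsingleton.elim j default]

/-- The projection of `𝔤𝔩` onto `𝔰𝔩` along the scalar matrices. -/
def toSl (hn : (Nat.card n : k) ≠ 0) : Matrix n n k →ₗ⁅k⁆ LieAlgebra.SpecialLinear.sl n k where
  toFun X := ⟨tracelessPart X, trace_tracelessPart hn X⟩
  map_add' X Y := Subtype.ext (map_add tracelessPart X Y)
  map_smul' c X := Subtype.ext (map_smul tracelessPart c X)
  map_lie' {X Y} := Subtype.ext (tracelessPart.map_lie X Y)

theorem coe_toSl (hn : (Nat.card n : k) ≠ 0) (X : Matrix n n k) :
    (toSl hn X : Matrix n n k) = tracelessPart X := rfl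

end Traceless

section Blocks

variable {k : Type*} [Field k] {V : Type*} [Quiver V] {QB : WideSubquiver V} {p : V × V}

theorem extC_apply (X : Matrix (CArr QB p) (CArr QB p) k) (b a : CArr QB p) :
    extC k QB p X b.1 a.1 = X b a := by
  simp [extC, b.2, a.2]

theorem extC_zero : extC k QB p 0 = 0 := by
  ext b a
  simp [extC]

open scoped Classical in
theorem extC_one : extC k QB p 1 = elI k QB p := by
  ext b a
  rcases eq_or_ne b a with rfl | hba
  · by_cases hb : b ∈ QB p.1 p.2 <;> simp [extC, elI, hb]
  · simp [extC, elI, Matrix.one_apply, hba]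

variable [∀ i j : V, Fintype (i ⟶ j)]

open scoped Classical in
theorem extC_lie (X Y : Matrix (CArr QB p) (CArr QB p) k) :
    extC k QB p ⁅X, Y⁆ = ⁅extC k QB p X, extC k QB p Y⁆ := by
  rw [Ring.lie_def, Ring.lie_def, ← extC_mul, ← extC_mul, eq_sub_iff_add_eq, ← extC_add,
    sub_add_cancel]

theorem frakI_lie (N N' : frakI k QB p) : ⁅N, N'⁆ = 0 := by
  classical
  have mul_eq_zero (M M' : frakI k QB p) : M.1 * M'.1 = 0 := by
    ext b a
    rw [Matrix.mul_apply]
    refine Finset.sum_eq_zero fun c _ => ?_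
    by_cases hc : c ∈ QB p.1 p.2
    · rw [M.2 b c (Or.inl hc), zero_mul]
    · rw [M'.2 c a (Or.inr hc), mul_zero]
  refine Subtype.ext ?_
  change N.1 * N'.1 - N'.1 * N.1 = 0
  rw [mul_eq_zero, mul_eq_zero, sub_zero]

theorem extC_mem_relParLie (X : Matrix (CArr QB p) (CArr QB p) k) :
    extC k QB p X ∈ relParLie k QB p := fun b a ha => by simp [extC, ha]

theorem frakI_le_relParLie : frakI k QB p ≤ relParLie k QB p := fun _ hN b a ha =>
  hN b a (Or.inl ha)

open scoped Classical in
/-- The block of a matrix in the rows of the arrows of `Q_B` and the columns of the arrows of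
`Q_C`, extended by zero. -/
def mixedBlock : relParLie k QB p →ₗ[k] frakI k QB p where
  toFun M := ⟨Matrix.of fun b a => if a ∈ QB p.1 p.2 ∨ b ∉ QB p.1 p.2 then 0 else M.1 b a,
    fun b a h => by rw [Matrix.of_apply, if_pos h]⟩
  map_add' M N := Subtype.ext <| Matrix.ext fun b a => by
    change ite _ 0 (M.1 b a + N.1 b a) = ite _ 0 (M.1 b a) + ite _ 0 (N.1 b a)
    split_ifs <;> simp
  map_smul' c M := Subtype.ext <| Matrix.ext fun b a => by
    change ite _ 0 (c * M.1 b a) = c * ite _ 0 (M.1 b a)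
    split_ifs <;> simp

open scoped Classical in
theorem mixedBlock_apply (M : relParLie k QB p) (b a : Arr p) :
    (mixedBlock M).1 b a = if a ∈ QB p.1 p.2 ∨ b ∉ QB p.1 p.2 then 0 else M.1 b a := rfl

/-- The block of a matrix in the rows and columns of the arrows of `Q_C`. -/
def complBlock : relParLie k QB p →ₗ[k] Matrix (CArr QB p) (CArr QB p) k where
  toFun M := M.1.submatrix Subtype.val Subtype.val
  map_add' _ _ := rfl
  map_smul' _ _ := rfl

theorem mixedBlock_add_extC_complBlock (M : relParLie k QB p) :
    (mixedBlock M).1 + extC k QB p (complBlock M) = M.1 := by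
  ext b a
  rw [Matrix.add_apply, mixedBlock_apply]
  by_cases ha : a ∈ QB p.1 p.2
  · simp [ha, extC, M.2 b a ha]
  · by_cases hb : b ∈ QB p.1 p.2
    · simp [ha, hb, extC]
    · rw [if_pos (Or.inr hb), zero_add]
      exact extC_apply (complBlock M) ⟨b, hb⟩ ⟨a, ha⟩

theorem mixedBlock_eq {M : relParLie k QB p} {N : frakI k QB p}
    {X : Matrix (CArr QB p) (CArr QB p) k} (h : M.1 = N.1 + extC k QB p X) :
    mixedBlock M = N := by
  refine Subtype.ext (Matrix.ext fun b a => ?_)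
  rw [mixedBlock_apply, h, Matrix.add_apply]
  split_ifs with hba
  · exact (N.2 b a hba).symm
  · simp only [not_or, not_not] at hba
    simp [extC, hba.2]

theorem complBlock_eq {M : relParLie k QB p} {N : frakI k QB p}
    {X : Matrix (CArr QB p) (CArr QB p) k} (h : M.1 = N.1 + extC k QB p X) :
    complBlock M = X := by
  ext b a
  change M.1 b.1 a.1 = X b a
  rw [h, Matrix.add_apply, N.2 _ _ (Or.inr b.2), zero_add, extC_apply]

open scoped Classical in
theorem coe_lie_eq_blocks (M M' : relParLie k QB p) :
    ⁅M.1, M'.1⁆ = (⁅extC k QB p (complBlock M), (mixedBlock M').1⁆ -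
      ⁅extC k QB p (complBlock M'), (mixedBlock M).1⁆) +
        extC k QB p ⁅complBlock M, complBlock M'⁆ := by
  have mixed_lie_mixed : ⁅(mixedBlock M).1, (mixedBlock M').1⁆ = 0 :=
    congrArg Subtype.val (frakI_lie (mixedBlock M) (mixedBlock M'))
  rw [← mixedBlock_add_extC_complBlock M, ← mixedBlock_add_extC_complBlock M', add_lie, lie_add,
    lie_add, mixed_lie_mixed, extC_lie, ← lie_skew (extC k QB p (complBlock M')) (mixedBlock M).1]
  abel

open scoped Classical in
theorem complBlock_lie (M M' : relParLie k QB p) :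
    complBlock ⁅M, M'⁆ = ⁅complBlock M, complBlock M'⁆ :=
  complBlock_eq (N := ⟨_, sub_mem (extC_lie_mem k QB p _ _ (mixedBlock M').2)
    (extC_lie_mem k QB p _ _ (mixedBlock M).2)⟩) (coe_lie_eq_blocks M M')

open scoped Classical in
theorem coe_mixedBlock_lie (M M' : relParLie k QB p) :
    (mixedBlock ⁅M, M'⁆).1 = ⁅extC k QB p (complBlock M), (mixedBlock M').1⁆ -
      ⁅extC k QB p (complBlock M'), (mixedBlock M).1⁆ :=
  congrArg Subtype.val <| mixedBlock_eq (N := ⟨_, sub_mem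
    (extC_lie_mem k QB p _ _ (mixedBlock M').2) (extC_lie_mem k QB p _ _ (mixedBlock M).2)⟩)
    (coe_lie_eq_blocks M M')

theorem exists_smul_elI (l : lineI k QB p) : ∃ c : k, l.1 = c • elI k QB p := by
  obtain ⟨c, hc⟩ := Submodule.mem_span_singleton.1 l.2
  exact ⟨c, hc.symm⟩

theorem lineI_le_relParLie : lineI k QB p ≤ relParLie k QB p := fun N hN => by
  obtain ⟨c, hc⟩ := exists_smul_elI ⟨N, hN⟩
  rw [show N = _ from hc, ← extC_one, ← extC_smul]
  exact extC_mem_relParLie _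

open scoped Classical in
/-- The projection to `k I_α`: the normalized trace of the block of the arrows of `Q_C`. -/
def lineBlock : relParLie k QB p →ₗ⁅k⁆ lineI k QB p where
  toFun M := ⟨normTrace (complBlock M) • elI k QB p, Submodule.mem_span_singleton.2 ⟨_, rfl⟩⟩
  map_add' M N := Subtype.ext <| by
    change normTrace (complBlock (M + N)) • elI k QB p =
      normTrace (complBlock M) • elI k QB p + normTrace (complBlock N) • elI k QB p
    rw [map_add, map_add, add_smul]
  map_smul' c M := Subtype.ext <| by
    change normTrace (complBlock (c • M)) • elI k QB p =
      c • normTrace (complBlock M) • elI k QB p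
    rw [map_smul, map_smul, smul_assoc]
  map_lie' {M N} := by
    refine (Subtype.ext ?_).trans (lineI_lie k QB p _ _).symm
    change normTrace (complBlock ⁅M, N⁆) • elI k QB p = 0
    rw [complBlock_lie, normTrace_lie, zero_smul]

open scoped Classical in
theorem coe_lineBlock (M : relParLie k QB p) :
    (lineBlock M).1 = normTrace (complBlock M) • elI k QB p := rfl

open scoped Classical in
theorem extC_complBlock (M : relParLie k QB p) :
    extC k QB p (complBlock M) =
      (lineBlock M).1 + extC k QB p (tracelessPart (complBlock M)) := by
  rw [coe_lineBlock, ← extC_one, ← extC_smul, ← extC_add, tracelessPart_apply, add_sub_cancel]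

open scoped Classical in
theorem sum_blocks (M : relParLie k QB p) :
    (mixedBlock M).1 + ((lineBlock M).1 + extC k QB p (tracelessPart (complBlock M))) = M.1 := by
  rw [← extC_complBlock, mixedBlock_add_extC_complBlock]

open scoped Classical in
/-- The projection to `𝔰𝔩_{|α|}(k)`: the trace zero part of the block of the arrows of `Q_C`. -/
def slBlock (hp : (Nat.card (CArr QB p) : k) ≠ 0) :
    relParLie k QB p →ₗ⁅k⁆ LieAlgebra.SpecialLinear.sl (CArr QB p) k where
  toFun M := toSl hp (complBlock M)
  map_add' M N := by rw [map_add, map_add]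
  map_smul' c M := by rw [map_smul, map_smul, RingHom.id_apply]
  map_lie' {M N} := by rw [complBlock_lie, LieHom.map_lie]

open scoped Classical in
theorem coe_slBlock (hp : (Nat.card (CArr QB p) : k) ≠ 0) (M : relParLie k QB p) :
    (slBlock hp M).1 = tracelessPart (complBlock M) :=
  coe_toSl hp _

open scoped Classical in
theorem blocks_eq (hp : (Nat.card (CArr QB p) : k) ≠ 0) {M : relParLie k QB p} {N : frakI k QB p}
    {l : lineI k QB p} {t : LieAlgebra.SpecialLinear.sl (CArr QB p) k}
    (h : M.1 = N.1 + (l.1 + extC k QB p t.1)) :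
    mixedBlock M = N ∧ lineBlock M = l ∧ slBlock hp M = t := by
  obtain ⟨c, hc⟩ := exists_smul_elI l
  rw [hc, ← extC_one, ← extC_smul, ← extC_add] at h
  refine ⟨mixedBlock_eq h, Subtype.ext ?_, Subtype.ext ?_⟩
  · rw [coe_lineBlock, complBlock_eq h, normTrace_smul_one_add hp c t.2, hc]
  · rw [coe_slBlock, complBlock_eq h, tracelessPart_smul_one_add hp c t.2]

open scoped Classical in
theorem blocks_eq_of_line (hp : (Nat.card (CArr QB p) : k) ≠ 0) {M : relParLie k QB p}
    {l : lineI k QB p} (h : M.1 = l.1) : mixedBlock M = 0 ∧ lineBlock M = l ∧ slBlock hp M = 0 := by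
  refine blocks_eq hp (h.trans ?_)
  change l.1 = 0 + (l.1 + extC k QB p 0)
  rw [extC_zero, add_zero, zero_add]

open scoped Classical in
theorem slAt_slBlock (hcard : ∀ p ∈ classes QB, (Nat.card (CArr QB p) : k) ≠ 0)
    (M : ∀ p, relParLie k QB p) (p : V × V) :
    slAt k QB p (fun q => slBlock (hcard q.1 q.2.1) (M q.1)) =
      extC k QB p (tracelessPart (complBlock (M p))) := by
  change (if h : p ∈ classesS QB then _ else 0) = _
  split_ifs with hp
  · rfl
  · have : Subsingleton (CArr QB p) := by
      rw [← Finite.card_le_one_iff_subsingleton]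
      by_contra! h
      exact hp ⟨(Nat.card_pos_iff.1 (by lia)).1, h⟩
    rw [tracelessPart_eq_zero, extC_zero]

end Blocks

section Coboundaries

variable {k : Type*} [Field k] {V : Type*} [Quiver V]

theorem coboundary_apply_self (g : V → k) (p : V × V) (a : Arr p) :
    coboundary g p a a = g p.1 - g p.2 := by
  simp [coboundary]

variable {QB : WideSubquiver V}

theorem mem_classesD_or_exists {p : V × V} (a : Arr p) :
    p ∈ classesD QB ∨ ∃ b : Arr p, b ∈ QB p.1 p.2 := by
  by_cases ha : a ∈ QB p.1 p.2
  · exact .inr ⟨a, ha⟩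
  · exact or_iff_not_imp_right.2 fun hb => ⟨⟨⟨a, ha⟩⟩, hb⟩

variable [∀ i j : V, Fintype (i ⟶ j)]

theorem delta0_apply (g : Cochain0 k V) (p : V × V) (a : Arr p) :
    delta0 k V g p a =
      (g p.1 ⟨Path.nil, by simp⟩ - g p.2 ⟨Path.nil, by simp⟩) • toB k a.toPath := by
  rw [sub_smul, ← linearCombination_left, ← linearCombination_right]
  rfl

/-- The cochain `∑ M b a • a // b` with values in the arrows. -/
def cochainOf (M : ∀ p : V × V, ParLie k p) : Cochain1 k V := fun p a =>
  ∑ b, M p b a • toB k b.toPath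

theorem cochainOf_apply_toPath (M : ∀ p : V × V, ParLie k p) (p : V × V) (b a : Arr p) :
    cochainOf M p a ⟨b.toPath, by simp⟩ = M p b a := by
  classical
  simp [cochainOf, toB, Finsupp.single_apply, Hom.toPath]

theorem cochainOf_injective : Function.Injective (cochainOf (k := k) (V := V)) := by
  intro M N h
  ext p b a
  rw [← cochainOf_apply_toPath M, h, cochainOf_apply_toPath]

theorem delta0_eq_cochainOf (g : Cochain0 k V) :
    delta0 k V g = cochainOf (coboundary fun i => g i ⟨Path.nil, by simp⟩) := by
  classical
  funext p a
  simp [delta0_apply, cochainOf, coboundary, Matrix.one_apply]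

open scoped Classical in
/-- Extension by zero of an element of `∏_{[α] ∈ D} k I_α` to all the classes. -/
def extD (x : ProdD k QB) (p : V × V) : ParLie k p :=
  if h : p ∈ classesD QB then (x ⟨p, h⟩).1 else 0

theorem extD_of_mem (x : ProdD k QB) {p : V × V} (h : p ∈ classesD QB) :
    extD x p = (x ⟨p, h⟩).1 := dif_pos h

theorem extD_of_notMem (x : ProdD k QB) {p : V × V} (h : p ∉ classesD QB) :
    extD x p = 0 := dif_neg h

theorem prodDIncl_eq_cochainOf (x : ProdD k QB) : prodDIncl k QB x = cochainOf (extD x) := by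
  classical
  funext p a
  by_cases h : p ∈ classesD QB <;> simp [prodDIncl, cochainOf, extD, h]

theorem mem_imIdeal_iff {x : ProdD k QB} :
    x ∈ imIdeal k QB ↔ ∃ g : V → k, extD x = coboundary g := by
  constructor
  · rintro ⟨⟨g, hg⟩, -⟩
    rw [delta0_eq_cochainOf, prodDIncl_eq_cochainOf] at hg
    exact ⟨_, (cochainOf_injective hg).symm⟩
  · rintro ⟨g, hg⟩
    refine ⟨⟨fun i => Finsupp.single ⟨Path.nil, by simp⟩ (g i), ?_⟩, fun p a ha => ?_⟩
    · rw [delta0_eq_cochainOf, prodDIncl_eq_cochainOf, hg]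
      simp only [Finsupp.single_eq_same]
    · rw [prodDIncl_eq_cochainOf, cochainOf, extD_of_notMem x fun h => h.2 ⟨a, ha⟩]
      simp

theorem prodD_lie (x y : ProdD k QB) : ⁅x, y⁆ = 0 :=
  funext fun p => lineI_lie k QB p.1 (x p) (y p)

theorem frakA_isLieAbelian : IsLieAbelian (frakA k QB) where
  trivial x y := by
    obtain ⟨x, rfl⟩ := LieSubmodule.Quotient.surjective_mk' _ x
    obtain ⟨y, rfl⟩ := LieSubmodule.Quotient.surjective_mk' _ y
    change ⁅(LieSubmodule.Quotient.mk x : frakA k QB), LieSubmodule.Quotient.mk y⁆ = 0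
    rw [← LieSubmodule.Quotient.mk_bracket, prodD_lie]
    rfl

theorem coboundary_eq_zero {p : V × V} {g : V → k} (hg : coboundary g p ∈ relParLie k QB p)
    (hp : p ∉ classesD QB) : coboundary g p = 0 := by
  ext b a
  obtain ⟨c, hc⟩ := (mem_classesD_or_exists a).resolve_left hp
  rw [coboundary, ← coboundary_apply_self g p c, hg c c hc, zero_smul]

end Coboundaries

section Decomposition

variable {k : Type*} [Field k] {V : Type*} [Quiver V] [∀ i j : V, Fintype (i ⟶ j)]
  {QB : WideSubquiver V}

theorem mixedBlock_of_mem_classesD {p : V × V} (hp : p ∈ classesD QB) (M : relParLie k QB p) :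
    mixedBlock M = 0 :=
  Subtype.ext <| Matrix.ext fun b a => by
    rw [mixedBlock_apply, if_pos (Or.inr fun hb => hp.2 ⟨b, hb⟩)]
    rfl

open scoped Classical in
theorem coe_mixedBlock_lie_eq_actions (hcard : ∀ p ∈ classes QB, (Nat.card (CArr QB p) : k) ≠ 0)
    (M M' : ∀ p, relParLie k QB p) (p : V × V) :
    (mixedBlock ⁅M p, M' p⁆).1 =
      ⁅(mixedBlock (M p)).1, (mixedBlock (M' p)).1⁆ +
        ⁅(lineBlock (M p)).1, (mixedBlock (M' p)).1⁆ -
        ⁅(lineBlock (M' p)).1, (mixedBlock (M p)).1⁆ +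
        ⁅slAt k QB p (fun q => slBlock (hcard q.1 q.2.1) (M q.1)), (mixedBlock (M' p)).1⁆ -
        ⁅slAt k QB p (fun q => slBlock (hcard q.1 q.2.1) (M' q.1)), (mixedBlock (M p)).1⁆ := by
  have mixed_lie_mixed : ⁅(mixedBlock (M p)).1, (mixedBlock (M' p)).1⁆ = 0 :=
    congrArg Subtype.val (frakI_lie (mixedBlock (M p)) (mixedBlock (M' p)))
  rw [coe_mixedBlock_lie, extC_complBlock, extC_complBlock, slAt_slBlock, slAt_slBlock,
    mixed_lie_mixed, add_lie, add_lie]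
  abel

open scoped Classical in
/-- The decomposition of a family of matrices, one for each class of parallel arrows, into its
blocks. -/
def toDecomp (hcard : ∀ p ∈ classes QB, (Nat.card (CArr QB p) : k) ≠ 0) :
    (∀ p, relParLie k QB p) →ₗ⁅k⁆ Decomp k QB where
  toFun M := ⟨(fun p => ⟨mixedBlock (M p.1), lineBlock (M p.1)⟩,
    LieSubmodule.Quotient.mk fun p => lineBlock (M p.1)),
    fun p => slBlock (hcard p.1 p.2.1) (M p.1)⟩
  map_add' M N := LieAlgebra.SemiDirectSum.ext (Prod.ext (funext fun p =>
    LieAlgebra.SemiDirectSum.ext (map_add mixedBlock _ _) (map_add lineBlock _ _))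
    (congrArg LieSubmodule.Quotient.mk (funext fun _ => map_add lineBlock _ _)))
    (funext fun _ => map_add (slBlock _) _ _)
  map_smul' c M := LieAlgebra.SemiDirectSum.ext (Prod.ext (funext fun p =>
    LieAlgebra.SemiDirectSum.ext (map_smul mixedBlock _ _) (map_smul lineBlock _ _))
    (congrArg LieSubmodule.Quotient.mk (funext fun _ => map_smul lineBlock _ _)))
    (funext fun _ => map_smul (slBlock _) _ _)
  map_lie' {M M'} := by
    refine LieAlgebra.SemiDirectSum.ext (Prod.ext (funext fun p =>
      LieAlgebra.SemiDirectSum.ext (Subtype.ext ?_) ?_) ?_)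
      (funext fun p => LieHom.map_lie (slBlock (hcard p.1 p.2.1)) _ _)
    · exact coe_mixedBlock_lie_eq_actions hcard M M' p.1
    · change lineBlock ⁅M p.1, M' p.1⁆ = ⁅lineBlock (M p.1), lineBlock (M' p.1)⁆ + 0 - 0
      rw [LieHom.map_lie, add_zero, sub_zero]
    · change LieSubmodule.Quotient.mk (fun p : classesD QB => lineBlock ⁅M p.1, M' p.1⁆) =
        ⁅(LieSubmodule.Quotient.mk _ : frakA k QB), LieSubmodule.Quotient.mk _⁆ + 0 - 0
      rw [← LieSubmodule.Quotient.mk_bracket, add_zero, sub_zero]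
      exact congrArg LieSubmodule.Quotient.mk (funext fun p => LieHom.map_lie lineBlock _ _)

theorem coe_eq_extD_of_toDecomp_eq_zero
    {hcard : ∀ p ∈ classes QB, (Nat.card (CArr QB p) : k) ≠ 0} {M : ∀ p, relParLie k QB p}
    (h : toDecomp hcard M = 0) (p : V × V) :
    (M p).1 = extD (fun p : classesD QB => lineBlock (M p.1)) p := by
  classical
  have sum_mixed_line : (mixedBlock (M p)).1 + (lineBlock (M p)).1 = (M p).1 := by
    have traceless_eq_zero : extC k QB p (tracelessPart (complBlock (M p))) = 0 := by
      rw [← slAt_slBlock hcard M p]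
      exact (congrArg (slAt k QB p) (congrArg (fun d => d.right) h)).trans (map_zero _)
    rw [← sum_blocks (M p), traceless_eq_zero, add_zero]
  by_cases hD : p ∈ classesD QB
  · rw [extD_of_mem _ hD, ← sum_mixed_line, mixedBlock_of_mem_classesD hD]
    exact zero_add _
  · rw [extD_of_notMem _ hD]
    ext b a
    by_cases ha : a ∈ QB p.1 p.2
    · exact (M p).2 b a ha
    · have hE : p ∈ classesE QB := ⟨⟨⟨a, ha⟩⟩, (mem_classesD_or_exists a).resolve_left hD⟩
      have factor_eq_zero := congrFun (congrArg (fun d => d.left.1) h) ⟨p, hE⟩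
      have mixed_eq_zero : mixedBlock (M p) = 0 := congrArg (fun e => e.left) factor_eq_zero
      have line_eq_zero : lineBlock (M p) = 0 := congrArg (fun e => e.right) factor_eq_zero
      rw [← sum_mixed_line, mixed_eq_zero, line_eq_zero]
      exact add_zero (0 : k)

theorem toDecomp_eq_zero_iff_extD (hcard : ∀ p ∈ classes QB, (Nat.card (CArr QB p) : k) ≠ 0)
    {M : ∀ p, relParLie k QB p} :
    toDecomp hcard M = 0 ↔ (fun p : classesD QB => lineBlock (M p.1)) ∈ imIdeal k QB ∧
      ∀ p, (M p).1 = extD (fun p : classesD QB => lineBlock (M p.1)) p := by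
  refine ⟨fun h => ⟨LieSubmodule.Quotient.mk_eq_zero'.1 (congrArg (fun d => d.left.2) h),
    coe_eq_extD_of_toDecomp_eq_zero h⟩, ?_⟩
  rintro ⟨line_mem, hM⟩
  have eq_zero (p : V × V) (hp : p ∉ classesD QB) : M p = 0 :=
    Subtype.ext ((hM p).trans (extD_of_notMem _ hp))
  refine LieAlgebra.SemiDirectSum.ext (Prod.ext (funext fun p => LieAlgebra.SemiDirectSum.ext
    ?_ ?_) (LieSubmodule.Quotient.mk_eq_zero'.2 line_mem)) (funext fun p => ?_)
  · exact (congrArg mixedBlock (eq_zero p fun hD => hD.2 p.2.2)).trans (map_zero _)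
  · exact (congrArg lineBlock (eq_zero p fun hD => hD.2 p.2.2)).trans (map_zero _)
  · by_cases hD : p.1 ∈ classesD QB
    · exact (blocks_eq_of_line _ ((hM p.1).trans (extD_of_mem _ hD))).2.2
    · exact (congrArg (slBlock (hcard p.1 p.2.1)) (eq_zero p hD)).trans (map_zero _)

theorem lineBlock_of_eq_coboundary {p : V × V} (hp : p ∈ classesD QB)
    (hcard : (Nat.card (CArr QB p) : k) ≠ 0) {M : relParLie k QB p} {g : V → k}
    (hM : M.1 = coboundary g p) : (lineBlock M).1 = coboundary g p := by
  classical
  have coboundary_eq : coboundary g p = (g p.1 - g p.2) • elI k QB p := by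
    rw [coboundary]
    congr 1
    ext b a
    have ha : a ∉ QB p.1 p.2 := fun ha => hp.2 ⟨a, ha⟩
    by_cases hba : b = a <;> simp [elI, Matrix.one_apply, hba, ha]
  exact congrArg Subtype.val (blocks_eq_of_line hcard (M := M)
    (l := ⟨_, Submodule.mem_span_singleton.2 ⟨_, coboundary_eq.symm⟩⟩) hM).2.1

theorem toDecomp_eq_zero_iff (hcard : ∀ p ∈ classes QB, (Nat.card (CArr QB p) : k) ≠ 0)
    {M : ∀ p, relParLie k QB p} :
    toDecomp hcard M = 0 ↔ ∃ g : V → k, ∀ p, (M p).1 = coboundary g p := by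
  rw [toDecomp_eq_zero_iff_extD, mem_imIdeal_iff]
  constructor
  · rintro ⟨⟨g, hg⟩, hM⟩
    exact ⟨g, fun p => (hM p).trans (congrFun hg p)⟩
  · rintro ⟨g, hg⟩
    have extD_eq : extD (fun p : classesD QB => lineBlock (M p.1)) = coboundary g := by
      funext p
      by_cases hp : p ∈ classesD QB
      · rw [extD_of_mem _ hp, lineBlock_of_eq_coboundary hp (hcard p hp.1) (hg p)]
      · rw [extD_of_notMem _ hp, coboundary_eq_zero (hg p ▸ (M p).2) hp]
    exact ⟨⟨g, extD_eq⟩, fun p => (hg p).trans (congrFun extD_eq p).symm⟩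

theorem toDecomp_surjective (hcard : ∀ p ∈ classes QB, (Nat.card (CArr QB p) : k) ≠ 0) :
    Function.Surjective (toDecomp hcard) := by
  classical
  rintro ⟨⟨e, q⟩, s⟩
  obtain ⟨x, rfl⟩ := LieSubmodule.Quotient.surjective_mk' _ q
  let N : ∀ p, frakI k QB p := fun p => if h : p ∈ classesE QB then (e ⟨p, h⟩).left else 0
  let l : ∀ p, lineI k QB p := fun p => if h : p ∈ classesE QB then (e ⟨p, h⟩).right else
    if h : p ∈ classesD QB then x ⟨p, h⟩ else 0
  let t : ∀ p, LieAlgebra.SpecialLinear.sl (CArr QB p) k := fun p =>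
    if h : p ∈ classesS QB then s ⟨p, h⟩ else 0
  let M : ∀ p, relParLie k QB p := fun p => ⟨(N p).1 + ((l p).1 + extC k QB p (t p).1),
    add_mem (frakI_le_relParLie (N p).2) (add_mem (lineI_le_relParLie (l p).2)
      (extC_mem_relParLie _))⟩
  have blocks (p : V × V) (hp : p ∈ classes QB) : mixedBlock (M p) = N p ∧
      lineBlock (M p) = l p ∧ slBlock (hcard p hp) (M p) = t p := blocks_eq _ rfl
  refine ⟨M, LieAlgebra.SemiDirectSum.ext (Prod.ext (funext fun p => LieAlgebra.SemiDirectSum.ext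
    ?_ ?_) (congrArg LieSubmodule.Quotient.mk (funext fun p => ?_))) (funext fun p => ?_)⟩
  · refine (blocks p p.2.1).1.trans ?_
    simp only [N, dif_pos p.2]
  · refine (blocks p p.2.1).2.1.trans ?_
    simp only [l, dif_pos p.2]
  · refine (blocks p p.2.1).2.1.trans ?_
    have hE : p.1 ∉ classesE QB := fun h => p.2.2 h.2
    simp only [l, dif_neg hE, dif_pos p.2]
  · refine (blocks p p.2.1).2.2.trans ?_
    simp only [t, dif_pos p.2]

end Decomposition

section HochschildCohomology

variable {k V A : Type*} [Field k] [NeZero (2 : k)] [Quiver V]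
  [∀ i j : V, Fintype (i ⟶ j)] [Ring A] [Algebra k A] {QB : WideSubquiver V}

open scoped Classical in
theorem ArrowBasis.toDecomp_relDerMatrices_surjective (β : ArrowBasis k V A)
    (hcard : ∀ p ∈ classes QB, (Nat.card (CArr QB p) : k) ≠ 0) :
    Function.Surjective ((toDecomp hcard).comp (β.relDerMatrices QB)) := by
  rw [LieHom.coe_comp]
  exact (toDecomp_surjective hcard).comp (β.relDerMatrices_surjective QB)

variable [Finite V]

open scoped Classical in
theorem ArrowBasis.ker_toDecomp_relDerMatrices (β : ArrowBasis k V A)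
    (hcard : ∀ p ∈ classes QB, (Nat.card (CArr QB p) : k) ≠ 0) :
    ((toDecomp hcard).comp (β.relDerMatrices QB)).ker = relInn k (β.subalgebra QB) := by
  ext f
  rw [LieHom.mem_ker, LieHom.comp_apply, toDecomp_eq_zero_iff, mem_relInn_iff]
  simp only [coe_relDerMatrices_apply]

theorem ArrowBasis.nonempty_HH1_equiv_decomp (β : ArrowBasis k V A)
    (hcard : ∀ p ∈ classes QB, (Nat.card (CArr QB p) : k) ≠ 0) :
    Nonempty (HH1 k (β.subalgebra QB) ≃ₗ⁅k⁆ Decomp k QB) := by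
  have range_eq_top := (LieHom.range_eq_top _).2 (β.toDecomp_relDerMatrices_surjective hcard)
  have e := ((toDecomp hcard).comp (β.relDerMatrices QB)).quotKerEquivRange
  rw [range_eq_top, β.ker_toDecomp_relDerMatrices hcard] at e
  exact ⟨e.trans LieSubalgebra.topEquiv⟩

end HochschildCohomology

end RelHH

theorem mainTheorem6_general {k V A : Type*} [Field k] [NeZero (2 : k)] [Quiver V] [Fintype V]
    [∀ i j : V, Fintype (i ⟶ j)] [Ring A] [Algebra k A]
    (QB : WideSubquiver V) (B : Subalgebra k A) (ν : RelHH.PathAlgebra k V →ₐ[k] A)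
    (hν : RelHH.IsRadSqZeroPair ν QB B)
    (hcard : ∀ p ∈ RelHH.classes QB, (Nat.card (RelHH.CArr QB p) : k) ≠ 0) :
    Nonempty (RelHH.HH1 k B ≃ₗ⁅k⁆ RelHH.Decomp k QB) ∧ IsLieAbelian (RelHH.frakA k QB) := by
  rw [← hν.subalgebra_arrowBasis]
  exact ⟨hν.arrowBasis.nonempty_HH1_equiv_decomp hcard, RelHH.frakA_isLieAbelian⟩

theorem mainTheorem6 {k V A : Type*} [Field k] [CharZero k] [Quiver V] [Fintype V]
    [∀ i j : V, Fintype (i ⟶ j)] [Ring A] [Algebra k A]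
    (QB : WideSubquiver V) (B : Subalgebra k A) (ν : RelHH.PathAlgebra k V →ₐ[k] A)
    (hν : RelHH.IsRadSqZeroPair ν QB B) :
    Nonempty (RelHH.HH1 k B ≃ₗ⁅k⁆ RelHH.Decomp k QB) ∧ IsLieAbelian (RelHH.frakA k QB) :=
  mainTheorem6_general QB B ν hν fun p (_ : Nonempty (RelHH.CArr QB p)) =>
    Nat.cast_ne_zero.2 Nat.card_pos.ne'
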